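/- Fix a word size $w$ and the word RAM whose memory cells and registers hold $w$-bit words and which performs each of the following in one step: loading a constant, arithmetic ($+,-,\times$, integer division and remainder), bitwise operations and shifts on words, loads and stores at an address given by a program constant plus the content of a register, conditional jumps on equality or order, and appending a word to the output. A string attractor of a string $T[1..n]$ is a set $\Gamma\subseteq\{1,\dots,n\}$ of positions such that every substring $T[i..j]$ with $1\le i\le j\le n$ has an occurrence $T[i'..j']=T[i..j]$ with $k\in[i',j']$ for some $k\in\Gamma$. A string over $[1..\sigma]$ is packed by writing each letter with $\lceil\log_2\sigma\rceil$ bits and cutting the concatenation of these codes into $w$-bit words. There are a word-RAM program $P$ and a constant $C>0$ such that the following holds for all $w$ and $\sigma$, every nonempty string $T[1..n]$ over the alphabet $[1..\sigma]$ with $n<2^w$ and $\sigma\le 2^w$ (that is, lengths, positions and letters fit into a machine word), every string attractor $\Gamma$ of $T$, of size $\gamma$, and every integer $\tau\ge 2$. There is a data structure of at most $C\,(\gamma+\gamma\,\tau\log_\tau(n/\gamma))$ words such that, with the data structure in memory and given the starting position and the length $\ell$ of any substring of $T$, the program $P$ outputs that substring in packed form and halts after at most $C\,(1+\log_\tau(n/\gamma)+\ell\log_2(\sigma)/w)$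 steps. -/

import Mathlib

/-! ### Strings, attractors, packed strings

A string over the alphabet `[1..σ]` is a `List (Fin σ)`; the letter `c + 1` of `[1..σ]` is
represented by `c : Fin σ`.  Positions are numbered from `0`. -/

/-- The substring of length `l` of `T` that starts at position `i`
(used only when `i + l ≤ T.length`). -/
def substr {α : Type*} (T : List α) (i l : ℕ) : List α := (T.drop i).take l

/-- `Γ` is a string attractor of `T`: a set of positions of `T` such that every (nonempty) substring
of `T` has an occurrence in `T` that crosses a position of `Γ`. -/
def IsStringAttractor {α : Type*} (T : List α) (Γ : Finset ℕ) : Prop :=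
  (∀ j ∈ Γ, j < T.length) ∧
  ∀ i l : ℕ, 0 < l → i + l ≤ T.length →
    ∃ i' : ℕ, i' + l ≤ T.length ∧ substr T i' l = substr T i l ∧
      ∃ j ∈ Γ, i' ≤ j ∧ j < i' + l

/-- The packed representation of a string over an alphabet of size `σ` in words of `w` bits: each
letter is written with `⌈log₂ σ⌉` bits, the codes are concatenated (first letter in the least
significant bits), and the resulting bit string is cut into `⌈|s| ⌈log₂ σ⌉ / w⌉` words
(first word the least significant one). -/
def packed (w : ℕ) {σ : ℕ} (s : List (Fin σ)) : List (BitVec w) :=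
  (List.range ((s.length * Nat.clog 2 σ) ⌈/⌉ w)).map fun q =>
    BitVec.ofNat w (Nat.ofDigits (2 ^ Nat.clog 2 σ) (s.map Fin.val) / 2 ^ (w * q))

/-! ### The word RAM -/

namespace WordRAM

/-- The unit-cost binary operations on words. -/
inductive WordOp
  | add | sub | mul | div | mod | and | or | xor | shl | shr

/-- Arithmetic is modulo `2 ^ w`; `div` and `mod` are the unsigned ones; a shift by `w` or more
gives `0`. -/
def WordOp.eval {w : ℕ} : WordOp → BitVec w → BitVec w → BitVec w
  | .add, x, y => x + y
  | .sub, x, y => x - y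
  | .mul, x, y => x * y
  | .div, x, y => x / y
  | .mod, x, y => x % y
  | .and, x, y => x &&& y
  | .or, x, y => x ||| y
  | .xor, x, y => x ^^^ y
  | .shl, x, y => x <<< y.toNat
  | .shr, x, y => x >>> y.toNat

/-- Instructions.  `d`, `a`, `b` are register numbers, `base`, `c` and `target` are constants of
the program. -/
inductive Instr
  /-- `R[d] := c` -/
  | const (d c : ℕ)
  /-- `R[d] := R[a] o R[b]` -/
  | op (o : WordOp) (d a b : ℕ)
  /-- `R[d] := M[base + R[a]]` -/
  | load (d base a : ℕ)
  /-- `M[base + R[a]] := R[b]` -/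
  | store (base a b : ℕ)
  /-- if `R[a] = R[b]`, go to instruction `target` -/
  | jeq (a b target : ℕ)
  /-- if `R[a] < R[b]` (unsigned), go to instruction `target` -/
  | jlt (a b target : ℕ)
  /-- append the word `R[a]` to the output -/
  | emit (a : ℕ)
  | halt

/-- A configuration of the word RAM with words of `w` bits: program counter, registers (a program
names only finitely many of them), memory, and the words output so far. -/
structure Config (w : ℕ) where
  pc : ℕ
  reg : ℕ → BitVec w
  mem : ℕ → BitVec w
  out : List (BitVec w)

/-- The effect of a single instruction. -/
def exec {w : ℕ} (s : Config w) : Instr → Config w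
  | .const d c =>
      { s with pc := s.pc + 1, reg := Function.update s.reg d (BitVec.ofNat w c) }
  | .op o d a b =>
      { s with pc := s.pc + 1, reg := Function.update s.reg d (o.eval (s.reg a) (s.reg b)) }
  | .load d base a =>
      { s with pc := s.pc + 1,
               reg := Function.update s.reg d (s.mem (base + (s.reg a).toNat)) }
  | .store base a b =>
      { s with pc := s.pc + 1,
               mem := Function.update s.mem (base + (s.reg a).toNat) (s.reg b) }
  | .jeq a b target => { s with pc := if s.reg a = s.reg b then target else s.pc + 1 }
  | .jlt a b target => { s with pc := if s.reg a < s.reg b then target else s.pc + 1 }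
  | .emit a => { s with pc := s.pc + 1, out := s.out ++ [s.reg a] }
  | .halt => s

/-- One step of the program `P`; nothing happens if there is no instruction to execute. -/
def step (P : List Instr) {w : ℕ} (s : Config w) : Config w :=
  match P[s.pc]? with
  | some I => exec s I
  | none => s

/-- The program is at a `halt` instruction. -/
def Halted (P : List Instr) {w : ℕ} (s : Config w) : Prop := P[s.pc]? = some Instr.halt

/-- The starting configuration for a data structure `D` and a query with arguments `x` and `y`: `D`
occupies the first `D.length` memory cells, `x` and `y` are in registers `0` and `1`, and all
else is zero. -/
def start {w : ℕ} (D : List (BitVec w)) (x y : ℕ) : Config w where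
  pc := 0
  reg := fun r => if r = 0 then BitVec.ofNat w x else if r = 1 then BitVec.ofNat w y else 0
  mem := fun a => D.getD a 0
  out := []

/-- On the data structure `D` and the query `(x, y)`, the program `P` halts after `t` steps with
output `O`. -/
def Answers (P : List Instr) {w : ℕ} (D : List (BitVec w)) (x y t : ℕ) (O : List (BitVec w)) :
    Prop :=
  Halted P ((step P)^[t] (start D x y)) ∧ ((step P)^[t] (start D x y)).out = O

end WordRAM

/-! Let γ be the size of the attractor, k the number of letters that fit into a word, m = max(1,
⌈log_τ(n/γ)⌉) and h = m·k. Level 0 is the text. Level i, for 1 ≤ i ≤ K, consists of γ windows of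
length 4·H_i, one around each attractor position, where H_i = h·τ^(K-i). Each level i < K is cut
into at most 4γτ blocks of length H_{i+1}. The stretch of text of length 2·H_{i+1} from the start of
a block (cut off at the end of the text) has an occurrence crossing an attractor position, and this
occurrence lies in a window of level i+1; its place there is the pointer of the block. A piece of at
most h ≤ H_{i+1} letters that starts in the block lies inside the stretch, so following the pointer
only shifts it. After K pointers it is found on the last level, whose windows of length 4h are
stored explicitly in 4γm words.

Here K is the least number of levels with n ≤ 4γ·h·τ^K, so K ≤ m. A query is cut into chunks of at
most h letters; a chunk costs O(K) for the pointers and O(m) for the words read, so a query of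
length ℓ costs O(m)·(ℓ/(mk) + 1) = O(m + ℓ/k).

The pointers take 4γτK words. This is too many when log_τ(n/γ) is small, and the addresses must also
fit into a word. If K = 0 or the levels need more than n cells, the packed text itself is stored,
which is the same structure with no levels. For log_τ(n/γ) ≤ 1, Bernoulli's inequality gives n ≤ γ +
γτ·log_τ(n/γ).

The combinatorics is in `isPointer_pointer`, `window_split` and `attractorLayout_stored`. The
program is verified against an abstract `Layout` in `descent`, `read_loop` and `main_loop`. The
parameters are chosen in `exists_data_structure` and paid for in `space_bound` and `time_bound`. -/

/-! ### Base-B numerals and their binary words -/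

/-- The number whose base-`B` digits are `f 0, …, f (l - 1)`, least significant first. -/
def digitVal (B : ℕ) (f : ℕ → ℕ) (l : ℕ) : ℕ := ∑ u ∈ Finset.range l, f u * B ^ u

/-- The `q` lowest words of `w` bits of `V`. -/
def lowWords (w V q : ℕ) : List (BitVec w) :=
  (List.range q).map fun j => BitVec.ofNat w (V / 2 ^ (w * j))

theorem digitVal_add (B : ℕ) (f : ℕ → ℕ) (a l : ℕ) :
    digitVal B f (a + l) = digitVal B f a + B ^ a * digitVal B (fun u => f (a + u)) l := by
  unfold digitVal
  rw [Finset.sum_range_add, Finset.mul_sum]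
  congr 1
  exact Finset.sum_congr rfl fun u _ => by ring

theorem digitVal_congr {B : ℕ} {f g : ℕ → ℕ} {l : ℕ} (h : ∀ u < l, f u = g u) :
    digitVal B f l = digitVal B g l :=
  Finset.sum_congr rfl fun u hu => by rw [h u (Finset.mem_range.1 hu)]

theorem digitVal_lt {B : ℕ} {f : ℕ → ℕ} (h : ∀ u, f u < B) (l : ℕ) : digitVal B f l < B ^ l := by
  induction l with
  | zero => simp [digitVal]
  | succ l ih =>
    unfold digitVal at *
    rw [Finset.sum_range_succ, pow_succ]
    nlinarith [h l, Nat.mul_le_mul_right (B ^ l) (h l)]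

theorem digitVal_slice {B : ℕ} {f : ℕ → ℕ} (h : ∀ u, f u < B) {a t k : ℕ} (hk : a + t ≤ k) :
    digitVal B f k / B ^ a % B ^ t = digitVal B (fun u => f (a + u)) t := by
  have hB : 0 < B := (Nat.zero_le _).trans_lt (h 0)
  obtain ⟨d, rfl⟩ := Nat.exists_eq_add_of_le hk
  rw [Nat.add_assoc, digitVal_add, Nat.add_mul_div_left _ _ (pow_pos hB a),
    Nat.div_eq_of_lt (digitVal_lt h a), zero_add, digitVal_add, Nat.add_mul_mod_self_left,
    Nat.mod_eq_of_lt (digitVal_lt (fun u => h _) t)]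

theorem lowWords_append {w V v β q : ℕ} (hq : w * q ≤ β) :
    lowWords w (V + 2 ^ β * v) q = lowWords w V q := by
  refine List.map_congr_left fun j hj => BitVec.eq_of_toNat_eq ?_
  rw [List.mem_range] at hj
  have : w * j + w ≤ β := by nlinarith [Nat.mul_le_mul_left w hj]
  obtain ⟨d, rfl⟩ := Nat.exists_eq_add_of_le this
  rw [BitVec.toNat_ofNat, BitVec.toNat_ofNat, pow_add, pow_add, mul_assoc, mul_assoc,
    Nat.add_mul_div_left _ _ (by positivity), Nat.add_mul_mod_self_left]

/-! ### The program and the effect of its straight-line segments -/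

namespace WordRAM

/-- The extraction program. -/
def extractProg : List Instr :=
  -- Register 2 is always zero, so adding it is a move and `jeq 2 2` is an unconditional jump.
  -- Registers 0 and 1 hold the position and length still to be answered; 4 to 11 hold w, b, k, the
  -- chunk length, S, τ, K·S and H 1. Register 12 collects output bits and 13 counts them; 14 is the
  -- position on the current level, 15 the offset of its pointer table, 16 its block length, and 17
  -- the letters left in the chunk. Addresses start at 8, after the header.
  [.load 5 1 2, .jeq 5 2 55, .load 4 0 2, .load 6 2 2, .load 7 3 2, .load 8 4 2, .load 9 5 2,
   .load 10 6 2, .load 11 7 2, .const 3 1,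
   -- 10: next chunk
   .jeq 1 2 53, .op .add 17 7 2, .jlt 7 1 14, .op .add 17 1 2, .op .add 14 0 2, .op .add 15 2 2,
   .op .add 16 11 2, .op .sub 1 1 17, .op .add 0 0 17,
   -- 19: follow the pointers
   .jeq 15 10 28, .op .div 18 14 16, .op .add 18 18 15, .load 18 8 18, .op .mod 14 14 16,
   .op .add 14 14 18, .op .add 15 15 8, .op .div 16 16 9, .jeq 2 2 19,
   -- 28: read letters from one word
   .jeq 17 2 10, .op .mod 18 14 6, .op .sub 19 6 18, .jlt 19 17 33, .op .add 19 17 2,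
   .op .div 20 14 6, .op .add 20 20 10, .load 20 8 20, .op .mul 18 18 5, .op .shr 20 20 18,
   .op .mul 21 19 5, .op .shl 22 3 21, .op .mod 20 20 22, .op .add 14 14 19, .op .sub 17 17 19,
   .op .shl 22 20 13, .op .add 12 12 22, .op .add 22 13 21, .jlt 22 4 51, .emit 12,
   .op .sub 12 4 13, .op .shr 12 20 12, .op .sub 22 22 4, .op .add 13 22 2, .jeq 2 2 28,
   -- 53: flush
   .jeq 13 2 55, .emit 12, .halt]

/-- From `s`, the program reaches within `t` steps a configuration that satisfies `Q`. -/
def Runs {w : ℕ} (s : Config w) (t : ℕ) (Q : Config w → Prop) : Prop :=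
  ∃ t' ≤ t, Q ((step extractProg)^[t'] s)

variable {w : ℕ}

theorem Runs.refl {s : Config w} {t : ℕ} {Q : Config w → Prop} (h : Q s) : Runs s t Q :=
  ⟨0, Nat.zero_le _, h⟩

theorem Runs.trans {s : Config w} {t t' u : ℕ} {Q R : Config w → Prop} (h : Runs s t Q)
    (h' : ∀ s', Q s' → Runs s' t' R) (hu : t + t' ≤ u) : Runs s u R := by
  obtain ⟨a, ha, hQ⟩ := h
  obtain ⟨a', ha', hR⟩ := h' _ hQ
  exact ⟨a' + a, by omega, by rwa [Function.iterate_add_apply]⟩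

variable {r M : ℕ → BitVec w} {o : List (BitVec w)} {pc n d a b : ℕ} {Q : Config w → Prop}

theorem Runs.cons {s s' : Config w} (h : step extractProg s = s') (hr : Runs s' n Q) :
    Runs s (n + 1) Q := by
  obtain ⟨t, ht, hQ⟩ := hr
  exact ⟨t + 1, by omega, by rwa [Function.iterate_succ_apply, h]⟩

theorem Runs.mono {s : Config w} {n' : ℕ} (hr : Runs s n Q) (h : n ≤ n') : Runs s n' Q :=
  let ⟨t, ht, hQ⟩ := hr
  ⟨t, ht.trans h, hQ⟩

theorem Runs.const {c : ℕ} (hP : extractProg[pc]? = some (.const d c))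
    (h : Runs ⟨pc + 1, Function.update r d (BitVec.ofNat w c), M, o⟩ n Q) :
    Runs ⟨pc, r, M, o⟩ (n + 1) Q :=
  h.cons (by simp only [step, hP, exec])

theorem Runs.op {f : WordOp} (hP : extractProg[pc]? = some (.op f d a b))
    (h : Runs ⟨pc + 1, Function.update r d (f.eval (r a) (r b)), M, o⟩ n Q) :
    Runs ⟨pc, r, M, o⟩ (n + 1) Q :=
  h.cons (by simp only [step, hP, exec])

theorem Runs.load {c : ℕ} (hP : extractProg[pc]? = some (.load d c a))
    (h : Runs ⟨pc + 1, Function.update r d (M (c + (r a).toNat)), M, o⟩ n Q) :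
    Runs ⟨pc, r, M, o⟩ (n + 1) Q :=
  h.cons (by simp only [step, hP, exec])

theorem Runs.emit (hP : extractProg[pc]? = some (.emit a))
    (h : Runs ⟨pc + 1, r, M, o ++ [r a]⟩ n Q) : Runs ⟨pc, r, M, o⟩ (n + 1) Q :=
  h.cons (by simp only [step, hP, exec])

theorem Runs.jeq_of_eq {t : ℕ} (hP : extractProg[pc]? = some (.jeq a b t))
    (hab : r a = r b) (h : Runs ⟨t, r, M, o⟩ n Q) : Runs ⟨pc, r, M, o⟩ (n + 1) Q :=
  h.cons (by simp only [step, hP, exec, if_pos hab])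

theorem Runs.jeq_of_ne {t : ℕ} (hP : extractProg[pc]? = some (.jeq a b t))
    (hab : r a ≠ r b) (h : Runs ⟨pc + 1, r, M, o⟩ n Q) : Runs ⟨pc, r, M, o⟩ (n + 1) Q :=
  h.cons (by simp only [step, hP, exec, if_neg hab])

theorem Runs.jlt_of_lt {t : ℕ} (hP : extractProg[pc]? = some (.jlt a b t))
    (hab : r a < r b) (h : Runs ⟨t, r, M, o⟩ n Q) : Runs ⟨pc, r, M, o⟩ (n + 1) Q :=
  h.cons (by simp only [step, hP, exec, if_pos hab])

theorem Runs.jlt_of_not_lt {t : ℕ} (hP : extractProg[pc]? = some (.jlt a b t))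
    (hab : ¬ r a < r b) (h : Runs ⟨pc + 1, r, M, o⟩ n Q) : Runs ⟨pc, r, M, o⟩ (n + 1) Q :=
  h.cons (by simp only [step, hP, exec, if_neg hab])

theorem add_eq_of_eq_zero {x z : BitVec w} (hz : z = 0) : x + z = x := by
  rw [hz]; exact BitVec.add_zero x

theorem descent_exit (h : r 15 = r 10) : Runs ⟨19, r, M, o⟩ 1 (· = ⟨28, r, M, o⟩) :=
  .jeq_of_eq rfl h (.refl rfl)

theorem descent_body (h : r 15 ≠ r 10) :
    Runs ⟨19, r, M, o⟩ 9 fun s => ∃ r' : ℕ → BitVec w, s = ⟨19, r', M, o⟩ ∧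
      r' 14 = r 14 % r 16 + M (8 + (r 14 / r 16 + r 15).toNat) ∧
      r' 15 = r 15 + r 8 ∧ r' 16 = r 16 / r 9 ∧ ∀ j, j ≤ 13 ∨ j = 17 → r' j = r j := by
  refine .jeq_of_ne rfl h <| .op rfl <| .op rfl <| .load rfl <| .op rfl <| .op rfl <| .op rfl <|
    .op rfl <| .jeq_of_eq rfl rfl <| .refl ⟨_, rfl, rfl, rfl, rfl, ?_⟩
  rintro j (hj | rfl)
  · interval_cases j <;> rfl
  · rfl

theorem read_exit (h : r 17 = r 2) : Runs ⟨28, r, M, o⟩ 1 (· = ⟨10, r, M, o⟩) :=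
  .jeq_of_eq rfl h (.refl rfl)

theorem read_count (h : r 17 ≠ r 2) (h2 : r 2 = 0) :
    Runs ⟨28, r, M, o⟩ 5 fun s => ∃ r' : ℕ → BitVec w, s = ⟨33, r', M, o⟩ ∧
      r' 18 = r 14 % r 6 ∧
      r' 19 = (if r 6 - r 14 % r 6 < r 17 then r 6 - r 14 % r 6 else r 17) ∧
      ∀ j, j ≤ 17 → r' j = r j := by
  refine .jeq_of_ne rfl h <| .op rfl <| .op rfl ?_
  by_cases hlt : r 6 - r 14 % r 6 < r 17
  · refine .jlt_of_lt (n := 1) rfl hlt <| .refl ⟨_, rfl, rfl, ?_, ?_⟩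
    · rw [if_pos hlt]; rfl
    · intro j hj; interval_cases j <;> rfl
  · refine .jlt_of_not_lt rfl hlt <| .op (n := 0) rfl <| .refl ⟨_, rfl, rfl, ?_, ?_⟩
    · rw [if_neg hlt]; exact add_eq_of_eq_zero h2
    · intro j hj; interval_cases j <;> rfl

theorem read_word :
    Runs ⟨33, r, M, o⟩ 13 fun s => ∃ r' : ℕ → BitVec w, s = ⟨46, r', M, o⟩ ∧
      r' 20 = (M (8 + (r 14 / r 6 + r 10).toNat) >>> (r 18 * r 5).toNat) %
        (r 3 <<< (r 19 * r 5).toNat) ∧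
      r' 14 = r 14 + r 19 ∧ r' 17 = r 17 - r 19 ∧
      r' 12 = r 12 + r' 20 <<< (r 13).toNat ∧ r' 22 = r 13 + r 19 * r 5 ∧
      ∀ j, j ≤ 11 ∨ j = 13 → r' j = r j := by
  refine .op rfl <| .op rfl <| .load rfl <| .op rfl <| .op rfl <| .op rfl <| .op rfl <| .op rfl <|
    .op rfl <| .op rfl <| .op rfl <| .op rfl <| .op rfl <|
    .refl ⟨_, rfl, rfl, rfl, rfl, rfl, rfl, ?_⟩
  rintro j (hj | rfl)
  · interval_cases j <;> rfl
  · rfl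

theorem push_short (h : r 22 < r 4) (h2 : r 2 = 0) :
    Runs ⟨46, r, M, o⟩ 3 fun s => ∃ r' : ℕ → BitVec w, s = ⟨28, r', M, o⟩ ∧
      r' 12 = r 12 ∧ r' 13 = r 22 ∧ ∀ j, j ≤ 11 ∨ j = 14 ∨ j = 17 → r' j = r j := by
  refine .jlt_of_lt rfl h <| .op rfl <| .jeq_of_eq (n := 0) rfl rfl <|
    .refl ⟨_, rfl, rfl, add_eq_of_eq_zero h2, ?_⟩
  rintro j (hj | rfl | rfl)
  · interval_cases j <;> rfl
  · rfl
  · rfl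

theorem push_long (h : ¬ r 22 < r 4) (h2 : r 2 = 0) :
    Runs ⟨46, r, M, o⟩ 7 fun s => ∃ r' : ℕ → BitVec w, s = ⟨28, r', M, o ++ [r 12]⟩ ∧
      r' 12 = r 20 >>> (r 4 - r 13).toNat ∧ r' 13 = r 22 - r 4 ∧
      ∀ j, j ≤ 11 ∨ j = 14 ∨ j = 17 → r' j = r j := by
  refine .jlt_of_not_lt rfl h <| .emit rfl <| .op rfl <| .op rfl <| .op rfl <| .op rfl <|
    .jeq_of_eq (n := 0) rfl rfl <| .refl ⟨_, rfl, rfl, add_eq_of_eq_zero h2, ?_⟩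
  rintro j (hj | rfl | rfl)
  · interval_cases j <;> rfl
  · rfl
  · rfl

theorem chunk_length (h : r 1 ≠ r 2) (h2 : r 2 = 0) :
    Runs ⟨10, r, M, o⟩ 4 fun s => ∃ r' : ℕ → BitVec w, s = ⟨14, r', M, o⟩ ∧
      r' 17 = (if r 7 < r 1 then r 7 else r 1) ∧ ∀ j, j ≤ 13 → r' j = r j := by
  refine .jeq_of_ne rfl h <| .op rfl ?_
  by_cases hlt : r 7 < r 1
  · refine .jlt_of_lt (n := 1) rfl hlt <| .refl ⟨_, rfl, ?_, ?_⟩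
    · rw [if_pos hlt]; exact add_eq_of_eq_zero h2
    · intro j hj; interval_cases j <;> rfl
  · refine .jlt_of_not_lt rfl hlt <| .op (n := 0) rfl <| .refl ⟨_, rfl, ?_, ?_⟩
    · rw [if_neg hlt]; exact add_eq_of_eq_zero h2
    · intro j hj; interval_cases j <;> rfl

theorem main_body (h : r 1 ≠ r 2) (h2 : r 2 = 0) :
    Runs ⟨10, r, M, o⟩ 9 fun s => ∃ r' : ℕ → BitVec w, s = ⟨19, r', M, o⟩ ∧
      r' 17 = (if r 7 < r 1 then r 7 else r 1) ∧ r' 14 = r 0 ∧ r' 15 = 0 ∧ r' 16 = r 11 ∧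
      r' 1 = r 1 - r' 17 ∧ r' 0 = r 0 + r' 17 ∧ ∀ j, 2 ≤ j → j ≤ 13 → r' j = r j := by
  refine (chunk_length h h2).trans (t' := 5) ?_ le_rfl
  rintro s ⟨r₁, rfl, h17, hf⟩
  have hz : r₁ 2 = 0 := (hf 2 (by norm_num)).trans h2
  refine .op rfl <| .op rfl <| .op rfl <| .op rfl <| .op (n := 0) rfl <|
    .refl ⟨_, rfl, h17, (add_eq_of_eq_zero hz).trans (hf 0 (by norm_num)),
      (add_eq_of_eq_zero hz).trans hz, (add_eq_of_eq_zero hz).trans (hf 11 (by norm_num)),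
      congrArg (· - r₁ 17) (hf 1 (by norm_num)), congrArg (· + r₁ 17) (hf 0 (by norm_num)),
      fun j hj hj' => ?_⟩
  rw [← hf j hj']
  interval_cases j <;> rfl

theorem main_exit (h : r 1 = r 2) :
    Runs ⟨10, r, M, o⟩ 3 (· = ⟨55, r, M, o ++ if r 13 = r 2 then [] else [r 12]⟩) := by
  refine .jeq_of_eq rfl h ?_
  by_cases h' : r 13 = r 2
  · rw [if_pos h', List.append_nil]
    exact .jeq_of_eq (n := 1) rfl h' <| .refl rfl
  · rw [if_neg h']
    exact .jeq_of_ne rfl h' <| .emit (n := 0) rfl <| .refl rfl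

theorem init_trivial (h : M 1 = 0) (h2 : r 2 = 0) :
    Runs ⟨0, r, M, o⟩ 2 (fun s => s.pc = 55 ∧ s.out = o) := by
  refine .load rfl <| .jeq_of_eq (n := 0) rfl ?_ <| .refl ⟨rfl, rfl⟩
  change M (1 + (r 2).toNat) = r 2
  rw [h2]; exact h

theorem init_load (h : M 1 ≠ 0) (h2 : r 2 = 0) :
    Runs ⟨0, r, M, o⟩ 10 fun s => ∃ r' : ℕ → BitVec w, s = ⟨10, r', M, o⟩ ∧
      r' 3 = BitVec.ofNat w 1 ∧ r' 4 = M 0 ∧ r' 5 = M 1 ∧ r' 6 = M 2 ∧ r' 7 = M 3 ∧ r' 8 = M 4 ∧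
      r' 9 = M 5 ∧ r' 10 = M 6 ∧ r' 11 = M 7 ∧
      ∀ j, j ≤ 2 ∨ j = 12 ∨ j = 13 → r' j = r j := by
  have hM : ∀ a, M (a + (r 2).toNat) = M a := fun a => by rw [h2]; simp
  refine .load rfl <| .jeq_of_ne rfl ?_ <| .load rfl <| .load rfl <| .load rfl <| .load rfl <|
    .load rfl <| .load rfl <| .load rfl <| .const (n := 0) rfl <|
    .refl ⟨_, rfl, rfl, hM 0, hM 1, hM 2, hM 3, hM 4, hM 5, hM 6, hM 7, ?_⟩
  · change M (1 + (r 2).toNat) ≠ r 2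
    rw [hM, h2]; exact h
  · rintro j (hj | rfl | rfl)
    · interval_cases j <;> rfl
    · rfl
    · rfl

end WordRAM

/-! ### Output through a one-word bit buffer -/

/-- The program masks s bits by a remainder modulo 1 shifted left by s. For s = w the shifted word
is 0, but a remainder modulo 0 changes nothing, so the mask is still right. -/
theorem mod_two_pow_mod {y s w : ℕ} (hy : y < 2 ^ w) (hs : s ≤ w) :
    y % (2 ^ s % 2 ^ w) = y % 2 ^ s := by
  rcases hs.lt_or_eq with h | rfl
  · rw [Nat.mod_eq_of_lt (Nat.pow_lt_pow_right (by norm_num) h)]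
  · rw [Nat.mod_self, Nat.mod_zero, Nat.mod_eq_of_lt hy]

/-- The `β`-bit number `V` has been written in part: its full words are in `o`, the remaining
`used` bits are in `acc`. -/
structure Emitted {w : ℕ} (V β : ℕ) (acc used : BitVec w) (o : List (BitVec w)) : Prop where
  lt : V < 2 ^ β
  acc_eq : acc.toNat = V / 2 ^ (w * (β / w))
  used_eq : used.toNat = β % w
  out_eq : o = lowWords w V (β / w)

namespace Emitted

variable {w V β t : ℕ} {acc used v tb wr : BitVec w} {o : List (BitVec w)}

theorem high_eq (v : ℕ) :
    (V + 2 ^ β * v) / 2 ^ (w * (β / w)) = V / 2 ^ (w * (β / w)) + v * 2 ^ (β % w) := by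
  conv_lhs => rw [show 2 ^ β = 2 ^ (w * (β / w)) * 2 ^ (β % w) by rw [← pow_add, Nat.div_add_mod]]
  rw [mul_assoc, Nat.add_mul_div_left _ _ (by positivity), mul_comm v]

theorem acc_lt (h : Emitted V β acc used o) : acc.toNat < 2 ^ (β % w) := by
  rw [h.acc_eq, Nat.div_lt_iff_lt_mul (by positivity), ← pow_add, Nat.mod_add_div]
  exact h.lt

theorem lt_push (h : Emitted V β acc used o) (hv : v.toNat < 2 ^ t) :
    V + 2 ^ β * v.toNat < 2 ^ (β + t) := by
  rw [pow_add]
  have := h.lt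
  nlinarith [Nat.mul_le_mul_left (2 ^ β) (Nat.succ_le_of_lt hv)]

theorem push_toNat (h : Emitted V β acc used o) :
    (acc + v <<< used.toNat).toNat =
      (V + 2 ^ β * v.toNat) / 2 ^ (w * (β / w)) % 2 ^ w := by
  rw [high_eq, BitVec.toNat_add, BitVec.toNat_shiftLeft, Nat.shiftLeft_eq, Nat.add_mod_mod,
    h.acc_eq, h.used_eq]

/-- The bit count does not overflow: it stays below 2w ≤ 2^w. -/
theorem used_add (hw : 0 < w) (h : Emitted V β acc used o) (ht : t ≤ w) (htb : tb.toNat = t) :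
    (used + tb).toNat = β % w + t := by
  have := Nat.mod_lt β hw
  rw [BitVec.toNat_add, h.used_eq, htb, Nat.mod_eq_of_lt]
  have : w < 2 ^ w := Nat.lt_two_pow_self
  have h2 : w * 2 ≤ 2 ^ w := by
    obtain ⟨x, rfl⟩ := Nat.exists_eq_succ_of_ne_zero hw.ne'
    rw [pow_succ]
    exact Nat.mul_le_mul_right 2 Nat.lt_two_pow_self
  omega

theorem push_short (hw : 0 < w) (h : Emitted V β acc used o) (hv : v.toNat < 2 ^ t) (ht : t ≤ w)
    (htb : tb.toNat = t) (hwr : wr.toNat = w) (hlt : used + tb < wr) :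
    Emitted (V + 2 ^ β * v.toNat) (β + t) (acc + v <<< used.toNat) (used + tb) o := by
  rw [BitVec.lt_def, used_add hw h ht htb, hwr] at hlt
  have hdiv : (β + t) / w = β / w := by
    conv_lhs => rw [← Nat.div_add_mod β w]
    rw [add_assoc, Nat.mul_add_div hw, Nat.div_eq_of_lt hlt, add_zero]
  refine ⟨h.lt_push hv, ?_, ?_, ?_⟩
  · rw [h.push_toNat, hdiv, Nat.mod_eq_of_lt]
    rw [Nat.div_lt_iff_lt_mul (by positivity), ← pow_add]
    refine (h.lt_push hv).trans_le (Nat.pow_le_pow_right (by norm_num) ?_)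
    have := Nat.div_add_mod β w
    omega
  · rw [used_add hw h ht htb]
    conv_rhs => rw [← Nat.div_add_mod β w]
    rw [add_assoc, Nat.mul_add_mod, Nat.mod_eq_of_lt hlt]
  · rw [hdiv, lowWords_append (Nat.mul_div_le β w)]
    exact h.out_eq

/-- The buffer is full: overflow in the addition drops exactly the bits of `v` that do not fit in
the emitted word, and the right shift recovers them as the new buffer. -/
theorem push_long (hw : 0 < w) (h : Emitted V β acc used o) (hv : v.toNat < 2 ^ t) (ht : t ≤ w)
    (htb : tb.toNat = t) (hwr : wr.toNat = w) (hlt : ¬ used + tb < wr) :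
    Emitted (V + 2 ^ β * v.toNat) (β + t) (v >>> (wr - used).toNat) (used + tb - wr)
      (o ++ [acc + v <<< used.toNat]) := by
  have hu := used_add hw h ht htb
  rw [BitVec.lt_def, hu, hwr, not_lt] at hlt
  have hmod := Nat.mod_lt β hw
  have hsum : β + t = w * (β / w + 1) + (β % w + t - w) := by
    have := Nat.div_add_mod β w
    rw [mul_add]
    omega
  have hrest : β % w + t - w < w := by omega
  have hdiv : (β + t) / w = β / w + 1 := by
    rw [hsum, Nat.mul_add_div hw, Nat.div_eq_of_lt hrest, add_zero]
  refine ⟨h.lt_push hv, ?_, ?_, ?_⟩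
  · have hsub : (wr - used).toNat = w - β % w := by
      rw [BitVec.toNat_sub_of_le (by rw [BitVec.le_def, hwr, h.used_eq]; omega), hwr, h.used_eq]
    rw [hdiv, hsub, BitVec.toNat_ushiftRight, Nat.shiftRight_eq_div_pow, mul_add, mul_one, pow_add,
      ← Nat.div_div_eq_div_mul, high_eq, ← h.acc_eq]
    conv_rhs => rw [show 2 ^ w = 2 ^ (β % w) * 2 ^ (w - β % w) by
      rw [← pow_add, Nat.add_sub_cancel' hmod.le]]
    rw [← Nat.div_div_eq_div_mul, Nat.add_mul_div_right _ _ (by positivity),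
      Nat.div_eq_of_lt h.acc_lt, zero_add]
  · rw [BitVec.toNat_sub_of_le (by rw [BitVec.le_def, hwr, hu]; omega), hu, hwr]
    conv_rhs => rw [hsum]
    rw [Nat.mul_add_mod, Nat.mod_eq_of_lt hrest]
  · rw [hdiv, lowWords, List.range_succ, List.map_append, ← lowWords,
      lowWords_append (Nat.mul_div_le β w), ← h.out_eq, List.map_singleton]
    congr 2
    exact BitVec.eq_of_toNat_eq (by rw [h.push_toNat, BitVec.toNat_ofNat])

theorem flush (hw : 0 < w) (h : Emitted V β acc used o) :
    (o ++ if used = 0 then [] else [acc]) = lowWords w V (β ⌈/⌉ w) := by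
  have hu := h.used_eq
  have hmod := Nat.mod_lt β hw
  by_cases h0 : used = 0
  · rw [h0] at hu
    rw [if_pos h0, List.append_nil, h.out_eq, Nat.ceilDiv_eq_add_pred_div]
    congr 1
    have h0 : β % w = 0 := by simpa using hu.symm
    conv_rhs => rw [← Nat.div_add_mod β w, h0]
    rw [add_zero, Nat.add_sub_assoc hw, Nat.mul_add_div hw,
      Nat.div_eq_of_lt (show w - Nat.succ 0 < w by omega), add_zero]
  · have hpos : 0 < β % w := by
      rw [← hu, Nat.pos_iff_ne_zero]
      exact fun e => h0 (BitVec.eq_of_toNat_eq (by simpa using e))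
    have : β ⌈/⌉ w = β / w + 1 := by
      rw [Nat.ceilDiv_eq_add_pred_div]
      conv_lhs => rw [← Nat.div_add_mod β w]
      rw [show w * (β / w) + β % w + w - 1 = w * (β / w + 1) + (β % w - 1) by
        rw [mul_add]; omega, Nat.mul_add_div hw,
        Nat.div_eq_of_lt (show β % w - 1 < w by omega), add_zero]
    rw [if_neg h0, this, lowWords, List.range_succ, List.map_append, ← lowWords, ← h.out_eq,
      List.map_singleton, ← h.acc_eq, BitVec.ofNat_toNat, BitVec.setWidth_eq]

end Emitted

/-! ### Correctness and running time over an abstract layout -/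

namespace WordRAM

/-- The parameters of a data structure with `K` levels of pointers, `S` pointers at each level and
explicit text at the last level: `k` letters of `b` bits each are stored in a word, the queries
are cut into chunks of `m * k` letters, and `H i` is the block length below level `i`.
The text of length `n` is `c`, the explicit text is `E`, and `Rep i p y len` says that
position `p` of level `i` represents the substring of length `len` at position `y` of the text. -/
structure Layout where
  b : ℕ
  k : ℕ
  m : ℕ
  S : ℕ
  τ : ℕ
  K : ℕ
  n : ℕ
  H : ℕ → ℕ
  c : ℕ → ℕ
  E : ℕ → ℕ
  Rep : ℕ → ℕ → ℕ → ℕ → Prop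

/-- The memory `M` contains the data structure with the parameters `L`. -/
structure Layout.Stored (L : Layout) {w : ℕ} (M : ℕ → BitVec w) : Prop where
  w_pos : 0 < w
  b_pos : 0 < L.b
  k_pos : 0 < L.k
  m_pos : 0 < L.m
  kb_le : L.k * L.b ≤ w
  n_lt : L.n < 2 ^ w
  c_lt : ∀ i, L.c i < 2 ^ L.b
  E_lt : ∀ i, L.E i < 2 ^ L.b
  mem_w : (M 0).toNat = w
  mem_b : (M 1).toNat = L.b
  mem_k : (M 2).toNat = L.k
  mem_h : (M 3).toNat = min (L.m * L.k) L.n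
  mem_S : L.K ≠ 0 → (M 4).toNat = L.S
  mem_τ : L.K ≠ 0 → (M 5).toNat = L.τ
  mem_base : (M 6).toNat = L.K * L.S
  mem_H : L.K ≠ 0 → (M 7).toNat = L.H 1
  S_pos : L.K ≠ 0 → 0 < L.S
  H_succ : ∀ i, i + 1 < L.K → L.H (i + 1) / L.τ = L.H (i + 2)
  rep_zero : ∀ y len, 0 < len → y + len ≤ L.n → L.Rep 0 y y len
  rep_succ : ∀ i < L.K, ∀ p y len, L.Rep i p y len → len ≤ L.m * L.k →
    p / L.H (i + 1) + i * L.S < 2 ^ w ∧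
    p % L.H (i + 1) + (M (8 + (p / L.H (i + 1) + i * L.S))).toNat < 2 ^ w ∧
    L.Rep (i + 1) (p % L.H (i + 1) + (M (8 + (p / L.H (i + 1) + i * L.S))).toNat) y len
  rep_last : ∀ p y len, L.Rep L.K p y len → p + len < 2 ^ w ∧ ∀ u < len,
    L.E (p + u) = L.c (y + u) ∧ (p + u) / L.k + L.K * L.S < 2 ^ w ∧
    (M (8 + ((p + u) / L.k + L.K * L.S))).toNat =
      digitVal (2 ^ L.b) (fun v => L.E ((p + u) / L.k * L.k + v)) L.k

/-- The constants of the program are in the registers `2` to `11`. -/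
structure Loaded {w : ℕ} (r M : ℕ → BitVec w) : Prop where
  r2 : r 2 = 0
  r3 : r 3 = BitVec.ofNat w 1
  r4 : r 4 = M 0
  r5 : r 5 = M 1
  r6 : r 6 = M 2
  r7 : r 7 = M 3
  r8 : r 8 = M 4
  r9 : r 9 = M 5
  r10 : r 10 = M 6
  r11 : r 11 = M 7

variable {w : ℕ} {r r' M : ℕ → BitVec w} {o : List (BitVec w)} {L : Layout}

theorem Loaded.frame (h : Loaded r M) (hf : ∀ j, 2 ≤ j → j ≤ 11 → r' j = r j) : Loaded r' M := by
  obtain ⟨h2, h3, h4, h5, h6, h7, h8, h9, h10, h11⟩ := h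
  constructor <;> rw [hf _ (by norm_num) (by norm_num)] <;> assumption

/-- Induction on the number `d` of levels still to go, at nine steps per level. Since S > 0, the
table offset i·S reaches K·S only on the last level. -/
theorem descent (hL : L.Stored M) {y len d : ℕ} (hlen : len ≤ L.m * L.k) :
    ∀ (i : ℕ) (r : ℕ → BitVec w), i + d = L.K → Loaded r M → (r 15).toNat = i * L.S →
      (i < L.K → (r 16).toNat = L.H (i + 1)) → L.Rep i (r 14).toNat y len →
      Runs ⟨19, r, M, o⟩ (9 * d + 1) fun s => ∃ r', s = ⟨28, r', M, o⟩ ∧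
        L.Rep L.K (r' 14).toNat y len ∧ ∀ j, j ≤ 13 ∨ j = 17 → r' j = r j := by
  induction d with
  | zero =>
    intro i r hi hr h15 h16 hrep
    obtain rfl : i = L.K := hi
    refine (descent_exit ?_).trans (t' := 0) ?_ (by norm_num)
    · exact BitVec.eq_of_toNat_eq (by rw [h15, hr.r10, hL.mem_base])
    · rintro s rfl
      exact .refl ⟨r, rfl, hrep, fun _ _ => rfl⟩
  | succ d ih =>
    intro i r hi hr h15 h16 hrep
    have hiK : i < L.K := by omega
    have hK : L.K ≠ 0 := by omega
    have hb := (M 6).isLt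
    rw [hL.mem_base] at hb
    have hle : (i + 1) * L.S ≤ L.K * L.S := Nat.mul_le_mul_right _ hiK
    rw [add_mul, one_mul] at hle
    refine (descent_body ?_).trans (t' := 9 * d + 1) ?_ (by omega)
    · intro e
      have := congrArg BitVec.toNat e
      rw [h15, hr.r10, hL.mem_base] at this
      have := hL.S_pos hK
      omega
    · rintro s ⟨r₁, rfl, e14, e15, e16, hf⟩
      obtain ⟨h1, h2, h3⟩ := hL.rep_succ i hiK _ _ _ hrep hlen
      have ea : (r 14 / r 16 + r 15).toNat = (r 14).toNat / L.H (i + 1) + i * L.S := by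
        rw [BitVec.toNat_add, BitVec.toNat_udiv, h16 hiK, h15, Nat.mod_eq_of_lt h1]
      have e14' : (r₁ 14).toNat = (r 14).toNat % L.H (i + 1) +
          (M (8 + ((r 14).toNat / L.H (i + 1) + i * L.S))).toNat := by
        rw [e14, BitVec.toNat_add, BitVec.toNat_umod, h16 hiK, ea, Nat.mod_eq_of_lt h2]
      refine (ih (i + 1) r₁ (by omega) (hr.frame fun j _ hj => hf j (by omega)) ?_ ?_ ?_).trans
        (t' := 0) ?_ le_rfl
      · rw [e15, BitVec.toNat_add, h15, hr.r8, hL.mem_S hK, add_mul, one_mul,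
          Nat.mod_eq_of_lt (hle.trans_lt hb)]
      · intro hi'
        rw [e16, BitVec.toNat_udiv, h16 hiK, hr.r9, hL.mem_τ hK, hL.H_succ i hi']
      · rw [e14']; exact h3
      · rintro s ⟨r₂, rfl, hr₂, hf₂⟩
        exact .refl ⟨r₂, rfl, hr₂, fun j hj => (hf₂ j hj).trans (hf j hj)⟩

/-- The first `d` letters of the substring at position `y` have been written. -/
def Written (L : Layout) (r : ℕ → BitVec w) (o : List (BitVec w)) (y d : ℕ) : Prop :=
  Emitted (digitVal (2 ^ L.b) (fun u => L.c (y + u)) d) (d * L.b) (r 12) (r 13) o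

/-- The positions from `p` on hold the letters of the substring of length `len` at `y`. -/
def Readable (L : Layout) (M : ℕ → BitVec w) (p y len : ℕ) : Prop :=
  p + len < 2 ^ w ∧ ∀ u < len,
    L.E (p + u) = L.c (y + u) ∧ (p + u) / L.k + L.K * L.S < 2 ^ w ∧
    (M (8 + ((p + u) / L.k + L.K * L.S))).toNat =
      digitVal (2 ^ L.b) (fun v => L.E ((p + u) / L.k * L.k + v)) L.k

theorem Readable.drop {p y len t : ℕ} (h : Readable L M p y len) (ht : t ≤ len) :
    Readable L M (p + t) (y + t) (len - t) := by
  refine ⟨by have := h.1; omega, fun u hu => ?_⟩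
  rw [add_assoc, add_assoc]
  exact h.2 (t + u) (by omega)

/-- Reading the letters `p, …, p + t - 1` of one word. -/
theorem Readable.slice (hL : L.Stored M) {p y len t : ℕ} (h : Readable L M p y len) (ht : t ≤ len)
    (ht0 : 0 < t) (htk : p % L.k + t ≤ L.k) :
    (M (8 + (p / L.k + L.K * L.S))).toNat / 2 ^ (L.b * (p % L.k)) % 2 ^ (L.b * t) =
      digitVal (2 ^ L.b) (fun u => L.c (y + u)) t := by
  have h0 := h.2 0 (by omega)
  rw [add_zero] at h0
  rw [h0.2.2, pow_mul, pow_mul, digitVal_slice (fun _ => hL.E_lt _) htk]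
  refine digitVal_congr fun u hu => ?_
  rw [← (h.2 u (by omega)).1, ← add_assoc, mul_comm (p / L.k), Nat.div_add_mod]

/-- One round takes as many letters as the current word still offers or the chunk still needs. Hence
it either finishes the chunk or ends at a word boundary, which is what bounds the number of rounds.
-/
theorem read_body (hL : L.Stored M) {y d : ℕ} (hr : Loaded r M)
    (hread : Readable L M (r 14).toNat (y + d) (r 17).toNat) (hw : Written L r o y d)
    (h17 : (r 17).toNat ≠ 0) :
    ∃ t, 0 < t ∧ t ≤ (r 17).toNat ∧
      (t = (r 17).toNat ∨ (r 14).toNat % L.k + t = L.k) ∧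
      Runs ⟨28, r, M, o⟩ 25 fun s => ∃ r' o', s = ⟨28, r', M, o'⟩ ∧
        (r' 14).toNat = (r 14).toNat + t ∧ (r' 17).toNat = (r 17).toNat - t ∧
        Written L r' o' y (d + t) ∧ ∀ j, j ≤ 11 → r' j = r j := by
  set p := (r 14).toNat with hp
  set len := (r 17).toNat with hlen
  have hk := hL.k_pos
  have hmod : p % L.k < L.k := Nat.mod_lt _ hk
  have h6 : (r 6).toNat = L.k := by rw [hr.r6, hL.mem_k]
  have h5 : (r 5).toNat = L.b := by rw [hr.r5, hL.mem_b]
  have h4 : (r 4).toNat = w := by rw [hr.r4, hL.mem_w]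
  have hwlt : w < 2 ^ w := Nat.lt_two_pow_self
  have ha : (r 14 % r 6).toNat = p % L.k := by rw [BitVec.toNat_umod, h6]
  have hsub : (r 6 - r 14 % r 6).toNat = L.k - p % L.k := by
    rw [BitVec.toNat_sub_of_le (by rw [BitVec.le_def, ha, h6]; omega), ha, h6]
  refine ⟨min (L.k - p % L.k) len, by omega, by omega, by omega, ?_⟩
  set t := min (L.k - p % L.k) len with ht
  have htk : p % L.k + t ≤ L.k := by omega
  have htlen : t ≤ len := by omega
  have htb : t * L.b ≤ w := (Nat.mul_le_mul_right _ (by omega)).trans hL.kb_le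
  have hab : p % L.k * L.b ≤ w := (Nat.mul_le_mul_right _ (by omega)).trans hL.kb_le
  refine (read_count ?_ hr.r2).trans (t' := 20) ?_ le_rfl
  · intro e
    rw [hr.r2] at e
    exact h17 (by rw [hlen, e]; rfl)
  rintro s ⟨r₁, rfl, e18, e19, hf₁⟩
  have h19 : (r₁ 19).toNat = t := by
    rw [e19]
    split_ifs with hc
    · rw [BitVec.lt_def, hsub] at hc
      rw [hsub]; omega
    · rw [BitVec.lt_def, hsub] at hc
      omega
  refine read_word.trans (t' := 7) ?_ le_rfl
  rintro s ⟨r₂, rfl, e20, e14, e17, e12, e22, hf₂⟩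
  have f : ∀ j, j ≤ 11 → r₂ j = r j := fun j hj =>
    (hf₂ j (.inl hj)).trans (hf₁ j (by omega))
  have e13 : r₂ 13 = r 13 := (hf₂ 13 (.inr rfl)).trans (hf₁ 13 (by norm_num))
  have htb' : (r₁ 19 * r₁ 5).toNat = t * L.b := by
    rw [hf₁ 5 (by norm_num), BitVec.toNat_mul, h19, h5, Nat.mod_eq_of_lt (htb.trans_lt hwlt)]
  have hab' : (r₁ 18 * r₁ 5).toNat = p % L.k * L.b := by
    rw [hf₁ 5 (by norm_num), BitVec.toNat_mul, e18, ha, h5, Nat.mod_eq_of_lt (hab.trans_lt hwlt)]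
  have haddr : (r₁ 14 / r₁ 6 + r₁ 10).toNat = p / L.k + L.K * L.S := by
    have := (hread.2 0 (by omega)).2.1
    rw [add_zero] at this
    rw [hf₁ 14 (by norm_num), hf₁ 6 (by norm_num), hf₁ 10 (by norm_num), BitVec.toNat_add,
      BitVec.toNat_udiv, h6, hr.r10, hL.mem_base, Nat.mod_eq_of_lt this]
  have hv : (r₂ 20).toNat = digitVal (2 ^ L.b) (fun u => L.c (y + d + u)) t := by
    rw [e20, haddr, hab', htb', hf₁ 3 (by norm_num), hr.r3, BitVec.toNat_umod,
      BitVec.toNat_ushiftRight, Nat.shiftRight_eq_div_pow, BitVec.toNat_shiftLeft,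
      Nat.shiftLeft_eq, BitVec.toNat_ofNat,
      Nat.mod_eq_of_lt (Nat.one_lt_two_pow hL.w_pos.ne'), one_mul,
      mod_two_pow_mod ((Nat.div_le_self _ _).trans_lt (BitVec.isLt _)) htb,
      mul_comm _ L.b, mul_comm _ L.b]
    exact hread.slice hL htlen (by omega) htk
  have hvlt : (r₂ 20).toNat < 2 ^ (t * L.b) := by
    rw [hv, mul_comm, pow_mul]
    exact digitVal_lt (fun _ => hL.c_lt _) t
  have hval : digitVal (2 ^ L.b) (fun u => L.c (y + u)) (d + t) =
      digitVal (2 ^ L.b) (fun u => L.c (y + u)) d + 2 ^ (d * L.b) * (r₂ 20).toNat := by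
    rw [digitVal_add, hv, ← pow_mul, mul_comm L.b]
    simp only [add_assoc]
  have hplt := hread.1
  have h14 : (r₂ 14).toNat = p + t := by
    rw [e14, BitVec.toNat_add, hf₁ 14 (by norm_num), h19, Nat.mod_eq_of_lt (by omega)]
  have h17' : (r₂ 17).toNat = len - t := by
    rw [e17, hf₁ 17 (by norm_num),
      BitVec.toNat_sub_of_le (by rw [BitVec.le_def, h19]; exact htlen), h19]
  have h4' : (r₂ 4).toNat = w := by rw [f 4 (by norm_num), h4]
  rw [hf₁ 12 (by norm_num), hf₁ 13 (by norm_num)] at e12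
  rw [hf₁ 13 (by norm_num)] at e22
  by_cases hc : r₂ 22 < r₂ 4
  · refine (push_short hc ((f 2 (by norm_num)).trans hr.r2)).trans (t' := 0) ?_ (by norm_num)
    rintro s ⟨r₃, rfl, g12, g13, g⟩
    refine .refl ⟨r₃, o, rfl, by rw [g 14 (by norm_num), h14], by rw [g 17 (by norm_num), h17'],
      ?_, fun j hj => (g j (.inl hj)).trans (f j hj)⟩
    rw [e22] at hc
    have := Emitted.push_short hL.w_pos hw hvlt htb htb' h4' hc
    rw [Written, hval, add_mul, g12, g13, e12, e22]
    exact this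
  · refine (push_long hc ((f 2 (by norm_num)).trans hr.r2)).trans (t' := 0) ?_ (by norm_num)
    rintro s ⟨r₃, rfl, g12, g13, g⟩
    refine .refl ⟨r₃, _, rfl, by rw [g 14 (by norm_num), h14], by rw [g 17 (by norm_num), h17'],
      ?_, fun j hj => (g j (.inl hj)).trans (f j hj)⟩
    rw [e22] at hc
    have := Emitted.push_long hL.w_pos hw hvlt htb htb' h4' hc
    rw [Written, hval, add_mul, g12, g13, e12, e13, e22]
    exact this

theorem read_loop (hL : L.Stored M) {y : ℕ} (len : ℕ) :
    ∀ (d : ℕ) (r : ℕ → BitVec w) (o : List (BitVec w)), (r 17).toNat = len → Loaded r M →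
      Readable L M (r 14).toNat (y + d) len → Written L r o y d →
      Runs ⟨28, r, M, o⟩ (25 * (((r 14).toNat % L.k + len) / L.k + 1) + 1) fun s =>
        ∃ r' o', s = ⟨10, r', M, o'⟩ ∧ Written L r' o' y (d + len) ∧
          ∀ j, j ≤ 11 → r' j = r j := by
  induction len using Nat.strong_induction_on with
  | _ len ih =>
  intro d r o h17 hr hread hw
  by_cases h0 : len = 0
  · subst h0
    refine (read_exit ?_).trans (t' := 0) ?_ (by omega)
    · exact BitVec.eq_of_toNat_eq (by rw [h17, hr.r2]; simp)
    · rintro s rfl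
      exact .refl ⟨r, o, rfl, hw, fun _ _ => rfl⟩
  · have hk := hL.k_pos
    obtain ⟨t, ht0, htlen, hlast, hrun⟩ :=
      read_body hL hr (by rwa [h17]) hw (by rwa [h17])
    rw [h17] at htlen hlast hrun
    have htime : (((r 14).toNat + t) % L.k + (len - t)) / L.k + 1 ≤
        ((r 14).toNat % L.k + len) / L.k + 1 ∧ (t ≠ len →
        (((r 14).toNat + t) % L.k + (len - t)) / L.k + 1 ≤
        ((r 14).toNat % L.k + len) / L.k) := by
      -- A round that ends at a word boundary lowers the count of words still to be read by one.
      have key : (r 14).toNat % L.k + t = L.k → (((r 14).toNat + t) % L.k + (len - t)) / L.k + 1 =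
          ((r 14).toNat % L.k + len) / L.k := by
        intro e
        have : ((r 14).toNat + t) % L.k = 0 := by
          rw [← Nat.mod_add_mod, e, Nat.mod_self]
        rw [this, zero_add, show (r 14).toNat % L.k + len = (len - t) + L.k by omega,
          Nat.add_div_right _ hk]
      rcases hlast with rfl | e
      · refine ⟨?_, fun h => absurd rfl h⟩
        rw [Nat.sub_self, add_zero, Nat.div_eq_of_lt (Nat.mod_lt _ hk)]
        exact Nat.succ_le_succ (Nat.zero_le _)
      · exact ⟨(key e).le.trans (Nat.le_succ _), fun _ => (key e).le⟩
    by_cases htl : t = len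
    · refine hrun.trans (t' := 1) ?_
        (Nat.add_le_add_right (Nat.le_mul_of_pos_right 25 (Nat.succ_pos _)) 1)
      rintro s ⟨r₁, o₁, rfl, e14, e17, hw₁, hf⟩
      refine (read_exit ?_).trans (t' := 0) ?_ le_rfl
      · refine BitVec.eq_of_toNat_eq ?_
        rw [e17, hf 2 (by norm_num), hr.r2, htl, Nat.sub_self]; simp
      · rintro s rfl
        exact .refl ⟨r₁, o₁, rfl, htl ▸ hw₁, hf⟩
    · refine hrun.trans (t' := 25 * ((((r 14).toNat + t) % L.k + (len - t)) / L.k + 1) + 1) ?_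
        (by have := htime.2 htl; omega)
      rintro s ⟨r₁, o₁, rfl, e14, e17, hw₁, hf⟩
      have := ih (len - t) (by omega) (d + t) r₁ o₁ e17 (hr.frame fun j _ hj => hf j hj)
        (by rw [e14, ← add_assoc]; exact hread.drop htlen) hw₁
      rw [e14] at this
      refine this.trans (t' := 0) ?_ le_rfl
      rintro s ⟨r₂, o₂, rfl, hw₂, hf₂⟩
      rw [add_assoc, Nat.add_sub_cancel' htlen] at hw₂
      exact .refl ⟨r₂, o₂, rfl, hw₂, fun j hj => (hf₂ j hj).trans (hf j hj)⟩

/-- A bound for the time that a chunk takes. -/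
def Layout.chunkTime (L : Layout) : ℕ := 9 * L.K + 25 * L.m + 61

theorem main_loop (hL : L.Stored M) {y : ℕ} (l : ℕ) :
    ∀ (d : ℕ) (r : ℕ → BitVec w) (o : List (BitVec w)), (r 1).toNat = l →
      (r 0).toNat = y + d → y + d + l ≤ L.n → Loaded r M → Written L r o y d →
      Runs ⟨10, r, M, o⟩ (L.chunkTime * (l / (L.m * L.k) + 1) + 3) fun s =>
        s.pc = 55 ∧ s.out = lowWords w (digitVal (2 ^ L.b) (fun u => L.c (y + u)) (d + l))
          (((d + l) * L.b) ⌈/⌉ w) := by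
  induction l using Nat.strong_induction_on with
  | _ l ih =>
  intro d r o h1 h0 hn hr hw
  by_cases hl : l = 0
  · subst hl
    refine (main_exit ?_).trans (t' := 0) ?_ (by omega)
    · exact BitVec.eq_of_toNat_eq (by rw [h1, hr.r2]; simp)
    · rintro s rfl
      refine .refl ⟨rfl, ?_⟩
      simp only [hr.r2]
      exact hw.flush hL.w_pos
  have hh : 0 < L.m * L.k := Nat.mul_pos hL.m_pos hL.k_pos
  have h7 : (r 7).toNat = min (L.m * L.k) L.n := by rw [hr.r7, hL.mem_h]
  obtain ⟨x, hx⟩ : ∃ x, x = min (L.m * L.k) l := ⟨_, rfl⟩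
  have hnlt := hL.n_lt
  have hchunk : Runs ⟨10, r, M, o⟩ L.chunkTime fun s => ∃ r' o', s = ⟨10, r', M, o'⟩ ∧
      (r' 1).toNat = l - x ∧ (r' 0).toNat = y + (d + x) ∧ Loaded r' M ∧
      Written L r' o' y (d + x) := by
    refine (main_body ?_ hr.r2).trans (t' := 9 * L.K + 1 + (25 * (L.m + 2) + 1)) ?_
      (by unfold Layout.chunkTime; omega)
    · intro e
      rw [e, hr.r2] at h1
      exact hl (by simpa using h1.symm)
    rintro s ⟨r₁, rfl, e17, e14, e15, e16, e1, e0, hf⟩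
    -- The stored chunk length is capped at n so that it fits into a word; the cap is harmless
    -- because l ≤ n.
    have h17 : (r₁ 17).toNat = x := by
      rw [e17]
      split_ifs with hc <;> rw [BitVec.lt_def, h7, h1] at hc
      · rw [h7]; omega
      · rw [h1]; omega
    have h1' : (r₁ 1).toNat = l - x := by
      rw [e1, BitVec.toNat_sub_of_le (by rw [BitVec.le_def, h17, h1]; omega), h17, h1]
    have h0' : (r₁ 0).toNat = y + (d + x) := by
      rw [e0, BitVec.toNat_add, h17, h0, Nat.mod_eq_of_lt (by omega), add_assoc]
    have hr₁ : Loaded r₁ M := hr.frame fun j h h' => hf j h (by omega)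
    refine (descent hL (y := y + d) (len := x) (d := L.K) (by omega) 0 r₁ (zero_add _) hr₁
      (by rw [e15]; simp) (fun h => by rw [e16, hr.r11, hL.mem_H (by omega)])
      (by rw [e14, h0]; exact hL.rep_zero _ _ (by omega) (by omega))).trans
      (t' := 25 * (L.m + 2) + 1) ?_ le_rfl
    rintro s ⟨r₂, rfl, hrep, hf₂⟩
    have hread : Readable L M (r₂ 14).toNat (y + d) x := hL.rep_last _ _ _ hrep
    have hw₂ : Written L r₂ o y d := by
      rw [Written, hf₂ 12 (by norm_num), hf₂ 13 (by norm_num), hf 12 (by norm_num) (by norm_num),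
        hf 13 (by norm_num) (by norm_num)]
      exact hw
    have hr₂ : Loaded r₂ M := hr₁.frame fun j h h' => hf₂ j (by omega)
    refine ((read_loop hL x d r₂ o (by rw [hf₂ 17 (.inr rfl), h17]) hr₂ hread hw₂).mono ?_).trans
      (t' := 0) ?_ le_rfl
    · have : ((r₂ 14).toNat % L.k + x) / L.k ≤ L.m := by
        rw [← Nat.lt_succ_iff, Nat.div_lt_iff_lt_mul hL.k_pos, Nat.succ_mul]
        have := Nat.mod_lt (r₂ 14).toNat hL.k_pos
        omega
      omega
    · rintro s ⟨r₃, o₃, rfl, hw₃, hf₃⟩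
      exact .refl ⟨r₃, o₃, rfl, by rw [hf₃ 1 (by norm_num), hf₂ 1 (by norm_num), h1'],
        by rw [hf₃ 0 (by norm_num), hf₂ 0 (by norm_num), h0'],
        hr₂.frame fun j _ h => hf₃ j h, hw₃⟩
  refine hchunk.trans (t' := L.chunkTime * (l / (L.m * L.k)) + 3) ?_ (by rw [mul_add]; omega)
  rintro s ⟨r', o', rfl, h1', h0', hr', hw'⟩
  by_cases hlx : l ≤ L.m * L.k
  · have hxl : x = l := by omega
    refine (main_exit ?_).trans (t' := 0) ?_ (by omega)
    · exact BitVec.eq_of_toNat_eq (by rw [h1', hr'.r2, hxl]; simp)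
    · rintro s rfl
      refine .refl ⟨rfl, ?_⟩
      simp only [hr'.r2]
      rw [hxl] at hw'
      exact hw'.flush hL.w_pos
  · have hxl : x = L.m * L.k := by omega
    have hdiv : (l - x) / (L.m * L.k) + 1 = l / (L.m * L.k) := by
      rw [← Nat.add_div_right _ hh, hxl, Nat.sub_add_cancel (by omega)]
    have := ih (l - x) (by omega) (d + x) r' o' h1' h0' (by omega) hr' hw'
    rw [hdiv, add_assoc d, Nat.add_sub_cancel' (by omega)] at this
    exact this

/-- The program answers queries on a stored data structure. -/
theorem answers_of_stored {D : List (BitVec w)} (hL : L.Stored fun a => D.getD a 0) {y l : ℕ}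
    (hn : y + l ≤ L.n) :
    ∃ t ≤ L.chunkTime * (l / (L.m * L.k) + 1) + 13,
      Answers extractProg D y l t
        (lowWords w (digitVal (2 ^ L.b) (fun u => L.c (y + u)) l) ((l * L.b) ⌈/⌉ w)) := by
  have hnlt := hL.n_lt
  have hrun : Runs (start D y l) (L.chunkTime * (l / (L.m * L.k) + 1) + 13) fun s =>
      s.pc = 55 ∧
      s.out = lowWords w (digitVal (2 ^ L.b) (fun u => L.c (y + u)) l) ((l * L.b) ⌈/⌉ w) := by
    refine (init_load ?_ rfl).trans
      (t' := L.chunkTime * (l / (L.m * L.k) + 1) + 3) ?_ (by omega)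
    · intro e
      have := hL.mem_b
      rw [e] at this
      exact hL.b_pos.ne (by simpa using this)
    rintro s ⟨r', rfl, h3, h4, h5, h6, h7, h8, h9, h10, h11, hf⟩
    have h2 : r' 2 = 0 := hf 2 (by norm_num)
    have h12 : r' 12 = 0 := hf 12 (by norm_num)
    have h13 : r' 13 = 0 := hf 13 (by norm_num)
    have h0 : r' 0 = BitVec.ofNat w y := hf 0 (by norm_num)
    have h1 : r' 1 = BitVec.ofNat w l := hf 1 (by norm_num)
    have := main_loop hL (y := y) l 0 r' []
      (by rw [h1, BitVec.toNat_ofNat, Nat.mod_eq_of_lt (by omega)])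
      (by rw [h0, BitVec.toNat_ofNat, Nat.mod_eq_of_lt (by omega)]; rfl) hn
      ⟨h2, h3, h4, h5, h6, h7, h8, h9, h10, h11⟩
      (by rw [Written, h12, h13]; constructor <;> simp [digitVal, lowWords])
    rw [zero_add] at this
    exact this
  obtain ⟨t, ht, hpc, hout⟩ := hrun
  exact ⟨t, ht, by rw [Halted, hpc]; rfl, hout⟩

/-- If the letters have no bits, then the program stops without output. -/
theorem answers_of_mem_one_eq_zero {D : List (BitVec w)} (h : D.getD 1 0 = 0) (y l : ℕ) :
    ∃ t ≤ 2, Answers extractProg D y l t [] := by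
  obtain ⟨t, ht, hpc, hout⟩ := init_trivial (r := (start D y l).reg) (M := fun a => D.getD a 0)
    (o := []) h rfl
  exact ⟨t, ht, (congrArg (extractProg[·]?) hpc).trans rfl, hout⟩

end WordRAM

/-! ### Windows around attractor positions and pointers into them -/

/-- The text position that the position `p` of the concatenation of windows of length `4 * H`
around the positions in `G` stands for. -/
def window (G : List ℕ) (H p : ℕ) : ℕ := G.getD (p / (4 * H)) 0 - 2 * H + p % (4 * H)

/-- The text position of position `p` of level `i`; level `0` is the text itself. -/
def position (G : List ℕ) (H : ℕ → ℕ) : ℕ → ℕ → ℕ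
  | 0, p => p
  | i + 1, p => window G (H (i + 1)) p

/-- The text from position `x` on, up to length `2 * H`, occurs in the windows at position `p`. -/
def IsPointer (c : ℕ → ℕ) (n : ℕ) (G : List ℕ) (H x p : ℕ) : Prop :=
  p + min (2 * H) (n - x) ≤ 4 * G.length * H ∧ window G H p + min (2 * H) (n - x) ≤ n ∧
    ∀ v < min (2 * H) (n - x), window G H (p + v) = window G H p + v ∧
      c (window G H p + v) = c (x + v)

/-- A pointer to an occurrence in the windows of the text from position `x` on. -/
noncomputable def pointer (c : ℕ → ℕ) (n : ℕ) (G : List ℕ) (H x : ℕ) : ℕ :=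
  Classical.epsilon (IsPointer c n G H x)

/-- The list `G` contains an attractor of the text `c` of length `n`. -/
def Attracts (c : ℕ → ℕ) (n : ℕ) (G : List ℕ) : Prop :=
  ∀ x l, 0 < l → x + l ≤ n → ∃ x', x' + l ≤ n ∧ (∀ u < l, c (x' + u) = c (x + u)) ∧
    ∃ j ∈ G, x' ≤ j ∧ j < x' + l

section

variable {c : ℕ → ℕ} {n : ℕ} {G : List ℕ}

/-- An occurrence of length at most 2H that crosses the attractor position j lies within [j - 2H, j
+ 2H), the window of j. If j < 2H, truncated subtraction makes the window start at 0, and the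
occurrence still fits. -/
theorem isPointer_pointer (hG : Attracts c n G) {H x : ℕ} (hH : 0 < H) (hx : x < n) :
    IsPointer c n G H x (pointer c n G H x) := by
  refine Classical.epsilon_spec ?_
  obtain ⟨l, hl⟩ : ∃ l, l = min (2 * H) (n - x) := ⟨_, rfl⟩
  obtain ⟨x', hx', heq, j, hj, hxj, hjx⟩ := hG x l (by omega) (by omega)
  obtain ⟨g, hg, rfl⟩ := List.getElem_of_mem hj
  have hwin : ∀ v < l, window G H (g * (4 * H) + (x' - (G[g] - 2 * H)) + v) = x' + v := by
    intro v hv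
    rw [window, add_assoc, mul_comm g, Nat.mul_add_div (by omega), Nat.mul_add_mod,
      Nat.div_eq_of_lt (by omega), Nat.mod_eq_of_lt (by omega), add_zero,
      List.getD_eq_getElem _ _ hg]
    omega
  have hwin0 := hwin 0 (by omega)
  rw [add_zero, add_zero] at hwin0
  refine ⟨g * (4 * H) + (x' - (G[g] - 2 * H)), ?_, ?_, ?_⟩
  · have : (g + 1) * (4 * H) ≤ G.length * (4 * H) := Nat.mul_le_mul_right _ hg
    rw [add_mul, one_mul] at this
    rw [← hl, show 4 * G.length * H = G.length * (4 * H) by ring]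
    omega
  · rw [hwin0, ← hl]; exact hx'
  · rw [← hl]
    exact fun v hv => ⟨by rw [hwin v hv, hwin0], by rw [hwin0, heq v hv]⟩

/-- The block length H' divides the window length 4H, so no block straddles two windows and the text
positions inside a block are consecutive. -/
theorem window_split {τ H H' : ℕ} (hH' : 0 < H') (h : H = τ * H') (p : ℕ) :
    window G H p = window G H (p / H' * H') + p % H' := by
  have e : 4 * H = H' * (4 * τ) := by rw [h]; ring
  rw [window, window, e, ← Nat.div_div_eq_div_mul p, ← Nat.div_div_eq_div_mul (p / H' * H'),
    Nat.mod_mul, Nat.mod_mul (x := p / H' * H'), Nat.mul_div_cancel _ hH', Nat.mul_mod_left]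
  ring

theorem position_split {τ : ℕ} {H : ℕ → ℕ} {i : ℕ} (hH' : 0 < H (i + 1))
    (h : i ≠ 0 → H i = τ * H (i + 1)) (p : ℕ) :
    position G H i p = position G H i (p / H (i + 1) * H (i + 1)) + p % H (i + 1) := by
  cases i with
  | zero => exact (Nat.div_add_mod' _ _).symm
  | succ i => exact window_split hH' (h (Nat.succ_ne_zero i)) p

end

/-! ### The memory image of the structure -/

namespace WordRAM

/-- The length of level `i`. -/
def levelLength (n γ : ℕ) (H : ℕ → ℕ) (i : ℕ) : ℕ := if i = 0 then n else 4 * γ * H i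

/-- The data structure for the text `c` of length `n` with attractor `G`. -/
def attractorLayout (b k m τ K n : ℕ) (c : ℕ → ℕ) (G : List ℕ) : Layout where
  b := b
  k := k
  m := m
  S := 4 * G.length * τ
  τ := τ
  K := K
  n := n
  H i := m * k * τ ^ (K - i)
  c := c
  E p := c (position G (fun i => m * k * τ ^ (K - i)) K p)
  Rep i p y len :=
    0 < len ∧ p + len ≤ levelLength n G.length (fun i => m * k * τ ^ (K - i)) i ∧
      position G (fun i => m * k * τ ^ (K - i)) i p + len ≤ n ∧
      ∀ u < len, position G (fun i => m * k * τ ^ (K - i)) i (p + u) =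
        position G (fun i => m * k * τ ^ (K - i)) i p + u ∧
        c (position G (fun i => m * k * τ ^ (K - i)) i p + u) = c (y + u)

/-- The memory cells after the first eight: the pointers of the levels, then the explicit text. -/
noncomputable def Layout.body (L : Layout) (G : List ℕ) (a : ℕ) : ℕ :=
  if a < L.K * L.S then
    pointer L.c L.n G (L.H (a / L.S + 1)) (position G L.H (a / L.S) (a % L.S * L.H (a / L.S + 1)))
  else digitVal (2 ^ L.b) (fun v => L.E ((a - L.K * L.S) * L.k + v)) L.k

/-- The memory words of a data structure with `Z` words of explicit text. -/
noncomputable def Layout.words (L : Layout) (w : ℕ) (G : List ℕ) (Z : ℕ) : List (BitVec w) :=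
  (([w, L.b, L.k, min (L.m * L.k) L.n, L.S, L.τ, L.K * L.S, L.H 1] ++
    (List.range (L.K * L.S + Z)).map (L.body G)).map (BitVec.ofNat w))

theorem Layout.length_words (L : Layout) (w : ℕ) (G : List ℕ) (Z : ℕ) :
    (L.words w G Z).length = L.K * L.S + Z + 8 := by
  simp [words]

theorem Layout.getD_words (L : Layout) {w : ℕ} {G : List ℕ} {Z a : ℕ} (ha : a < L.K * L.S + Z) :
    (L.words w G Z).getD (8 + a) 0 = BitVec.ofNat w (L.body G a) := by
  rw [words, List.map_append, List.getD_append_right _ _ _ _ (by simp)]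
  simp [ha]

/-- The bounds in `hK` make every level after the text at most n long, let S blocks cover the text,
and keep the pointer tables within n cells, so that pointers and addresses fit into words. For K = 0
they are not needed: τ and S may then overflow in the header, but they are never used. -/
theorem attractorLayout_stored {w b k m τ K n Z : ℕ} {c : ℕ → ℕ} {G : List ℕ} (hG : Attracts c n G)
    (hG0 : G ≠ []) (hw : 0 < w) (hb : 0 < b) (hk : 0 < k) (hm : 0 < m) (hkb : k * b ≤ w)
    (hn : n < 2 ^ w) (hc : ∀ i, c i < 2 ^ b) (hτ : 0 < τ)
    (hK : K ≠ 0 → 4 * G.length * (m * k * τ ^ (K - 1)) ≤ n ∧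
      n ≤ 4 * G.length * (m * k * τ ^ K) ∧ K * (4 * G.length * τ) ≤ n)
    (hZ : levelLength n G.length (fun i => m * k * τ ^ (K - i)) K ≤ Z * k)
    (haddr : ∀ p < levelLength n G.length (fun i => m * k * τ ^ (K - i)) K,
      p / k + K * (4 * G.length * τ) < 2 ^ w) :
    (attractorLayout b k m τ K n c G).Stored
      fun a => ((attractorLayout b k m τ K n c G).words w G Z).getD a 0 := by
  obtain ⟨L, hL⟩ : ∃ L, L = attractorLayout b k m τ K n c G := ⟨_, rfl⟩
  obtain ⟨H, hH⟩ : ∃ H : ℕ → ℕ, H = fun i => m * k * τ ^ (K - i) := ⟨_, rfl⟩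
  have hγ : 0 < G.length := List.length_pos_iff.2 hG0
  have hwlt : w < 2 ^ w := Nat.lt_two_pow_self
  have hHpos : ∀ i, 0 < H i := fun i => by rw [hH]; positivity
  have hHsucc : ∀ i < K, H i = τ * H (i + 1) := fun i hi => by
    simp only [hH]
    rw [show K - i = K - (i + 1) + 1 by omega, pow_succ]; ring
  have hHmono : ∀ i < K, H (i + 1) ≤ H 1 := fun i hi => by
    simp only [hH]
    exact Nat.mul_le_mul_left _ (Nat.pow_le_pow_right hτ (by omega))
  have hH1 : H 1 = m * k * τ ^ (K - 1) := by rw [hH]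
  have hH0 : H 0 = m * k * τ ^ K := by rw [hH]; rfl
  have hlen : ∀ i ≤ K, levelLength n G.length H i ≤ n := by
    intro i hi
    unfold levelLength
    split_ifs with h
    · exact le_rfl
    · refine le_trans (Nat.mul_le_mul_left _ ?_) (hK (by omega)).1
      rw [← hH1]
      obtain ⟨j, rfl⟩ := Nat.exists_eq_succ_of_ne_zero h
      exact hHmono j hi
  have hS : K ≠ 0 → 4 * G.length * τ < 2 ^ w := fun h =>
    ((Nat.le_mul_of_pos_left _ (Nat.pos_of_ne_zero h)).trans (hK h).2.2).trans_lt hn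
  have hKS : K * (4 * G.length * τ) < 2 ^ w := by
    by_cases h : K = 0
    · rw [h, zero_mul]; positivity
    · exact (hK h).2.2.trans_lt hn
  have hE : ∀ p, c (position G H K p) < 2 ^ b := fun p => hc _
  constructor
  · exact hw
  · exact hb
  · exact hk
  · exact hm
  · exact hkb
  · exact hn
  · exact hc
  · exact fun _ => hc _
  · change (BitVec.ofNat w w).toNat = w
    rw [BitVec.toNat_ofNat, Nat.mod_eq_of_lt hwlt]
  · change (BitVec.ofNat w b).toNat = b
    rw [BitVec.toNat_ofNat, Nat.mod_eq_of_lt]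
    exact (Nat.le_mul_of_pos_left b hk).trans_lt (hkb.trans_lt hwlt)
  · change (BitVec.ofNat w k).toNat = k
    rw [BitVec.toNat_ofNat, Nat.mod_eq_of_lt]
    exact (Nat.le_mul_of_pos_right k hb).trans_lt (hkb.trans_lt hwlt)
  · change (BitVec.ofNat w (min (m * k) n)).toNat = min (m * k) n
    rw [BitVec.toNat_ofNat, Nat.mod_eq_of_lt ((min_le_right _ _).trans_lt hn)]
  · intro h
    change (BitVec.ofNat w (4 * G.length * τ)).toNat = _
    rw [BitVec.toNat_ofNat, Nat.mod_eq_of_lt (hS h)]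
    rfl
  · intro h
    change (BitVec.ofNat w τ).toNat = τ
    rw [BitVec.toNat_ofNat, Nat.mod_eq_of_lt]
    exact (Nat.le_mul_of_pos_left τ (by omega)).trans_lt (hS h)
  · change (BitVec.ofNat w (K * (4 * G.length * τ))).toNat = _
    rw [BitVec.toNat_ofNat, Nat.mod_eq_of_lt hKS]
    rfl
  · intro h
    change (BitVec.ofNat w (m * k * τ ^ (K - 1))).toNat = _
    rw [BitVec.toNat_ofNat, Nat.mod_eq_of_lt]
    · rfl
    · exact (Nat.le_mul_of_pos_left _ (by omega)).trans_lt ((hK h).1.trans_lt hn)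
  · exact fun _ => Nat.mul_pos (by omega) hτ
  · intro i hi
    change m * k * τ ^ (K - (i + 1)) / τ = m * k * τ ^ (K - (i + 2))
    have hi : i + 1 < K := hi
    rw [show K - (i + 1) = K - (i + 2) + 1 by omega, pow_succ, ← mul_assoc,
      Nat.mul_div_cancel _ hτ]
  · exact fun y len h0 hlen => ⟨h0, hlen, hlen, fun u _ => ⟨rfl, rfl⟩⟩
  · intro i hi p y len hrep hle
    rw [← hL]
    have hiK : i < K := hi
    have hK0 : K ≠ 0 := by omega
    have hle : len ≤ m * k := hle
    have hrep : 0 < len ∧ p + len ≤ levelLength n G.length H i ∧ position G H i p + len ≤ n ∧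
      ∀ u < len, position G H i (p + u) = position G H i p + u ∧
        c (position G H i p + u) = c (y + u) := by subst hH; exact hrep
    obtain ⟨h0, hp, hpos, hu⟩ := hrep
    have eS : L.S = 4 * G.length * τ := by rw [hL]; rfl
    have eK : L.K = K := by rw [hL]; rfl
    have eH : L.H = H := by rw [hL, hH]; rfl
    have en : L.n = n := by rw [hL]; rfl
    have ec : L.c = c := by rw [hL]; rfl
    rw [eS, eH]
    set S := 4 * G.length * τ with hSdef
    have hH' := hHpos (i + 1)
    have hq : p / H (i + 1) < S := by
      rw [Nat.div_lt_iff_lt_mul hH']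
      refine (show p < p + len by omega).trans_le (hp.trans ?_)
      have e : S * H (i + 1) = 4 * G.length * H i := by rw [hHsucc i hiK, hSdef]; ring
      rw [e]
      unfold levelLength
      split_ifs with h
      · rw [h, hH0]; exact (hK hK0).2.1
      · exact le_rfl
    have hqi : p / H (i + 1) + i * S < K * S := by
      have : (i + 1) * S ≤ K * S := Nat.mul_le_mul_right _ hiK
      rw [add_mul, one_mul] at this
      omega
    have hsplit : position G H i p =
        position G H i (p / H (i + 1) * H (i + 1)) + p % H (i + 1) :=
      position_split hH' (fun _ => hHsucc i hiK) p
    have hmod := Nat.mod_lt p hH'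
    obtain ⟨x, hx⟩ : ∃ x, x = position G H i (p / H (i + 1) * H (i + 1)) := ⟨_, rfl⟩
    rw [← hx] at hsplit
    obtain ⟨hq1, hq2, hq3⟩ := isPointer_pointer hG hH' (show x < n by omega)
    set p₀ := pointer c n G (H (i + 1)) x with hp₀
    have hmk : m * k ≤ H (i + 1) := by
      rw [hH]; exact Nat.le_mul_of_pos_right _ (pow_pos hτ _)
    -- The offset in the block is below H (i + 1) and the chunk has at most m·k ≤ H (i + 1) letters,
    -- hence the factor 2 in the stretch. The cut at n is harmless because the represented piece
    -- ends inside the text.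
    have hrest : p % H (i + 1) + len ≤ min (2 * H (i + 1)) (n - x) := by omega
    have hlevel : levelLength n G.length H (i + 1) = 4 * G.length * H (i + 1) :=
      if_neg (Nat.succ_ne_zero i)
    have hln := hlen (i + 1) hiK
    rw [hlevel] at hln
    have hmem : ((L.words w G Z).getD (8 + (p / H (i + 1) + i * S)) 0).toNat = p₀ := by
      rw [L.getD_words (by rw [eK, eS]; exact hqi.trans_le (Nat.le_add_right _ _)), Layout.body,
        if_pos (by rw [eK, eS]; exact hqi), eS,
        Nat.add_mul_div_right _ _ ((Nat.zero_le _).trans_lt hq), Nat.div_eq_of_lt hq, zero_add,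
        Nat.add_mul_mod_self_right, Nat.mod_eq_of_lt hq, eH, en, ec, ← hx, ← hp₀,
        BitVec.toNat_ofNat, Nat.mod_eq_of_lt (by omega)]
    rw [hmem]
    refine ⟨hqi.trans hKS, by omega, ?_⟩
    have goal : 0 < len ∧ p % H (i + 1) + p₀ + len ≤ levelLength n G.length H (i + 1) ∧
        position G H (i + 1) (p % H (i + 1) + p₀) + len ≤ n ∧
        ∀ u < len, position G H (i + 1) (p % H (i + 1) + p₀ + u) =
          position G H (i + 1) (p % H (i + 1) + p₀) + u ∧
          c (position G H (i + 1) (p % H (i + 1) + p₀) + u) = c (y + u) := by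
      have e0 : position G H (i + 1) (p % H (i + 1) + p₀) =
          window G (H (i + 1)) p₀ + p % H (i + 1) := by
        rw [add_comm (p % _)]; exact (hq3 (p % H (i + 1)) (by omega)).1
      refine ⟨h0, by omega, by omega, fun u hu' => ⟨?_, ?_⟩⟩
      · rw [e0, add_comm (p % H (i + 1)), add_assoc, add_assoc]
        exact (hq3 (p % H (i + 1) + u) (by omega)).1
      · rw [e0, add_assoc, (hq3 (p % H (i + 1) + u) (by omega)).2, ← add_assoc, ← hsplit, (hu u hu').2]
    subst hL hH
    exact goal
  · intro p y len hrep
    obtain ⟨-, hp, -, hu⟩ := hrep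
    rw [← hL]
    have eS : L.S = 4 * G.length * τ := by rw [hL]; rfl
    have eK : L.K = K := by rw [hL]; rfl
    have ek : L.k = k := by rw [hL]; rfl
    have eb : L.b = b := by rw [hL]; rfl
    have ec : L.c = c := by rw [hL]; rfl
    have eE : L.E = fun p => c (position G H K p) := by rw [hL, hH]; rfl
    have hp : p + len ≤ levelLength n G.length H K := by subst hL hH; exact hp
    have hu : ∀ u < len, position G H K (p + u) = position G H K p + u ∧
        c (position G H K p + u) = c (y + u) := by subst hL hH; exact hu
    rw [← hH] at hZ haddr
    have hln := hlen K le_rfl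
    refine ⟨by omega, fun u hu' => ⟨?_, ?_, ?_⟩⟩
    · rw [eE, ec, ← (hu u hu').2, ← (hu u hu').1]
    · rw [ek, eK, eS]; exact haddr _ (by omega)
    · have hlt : (p + u) / k < Z := by rw [Nat.div_lt_iff_lt_mul hk]; omega
      rw [L.getD_words (by rw [ek, add_comm]; exact Nat.add_lt_add_left hlt _), Layout.body,
        if_neg (not_lt.2 (Nat.le_add_left _ _)), Nat.add_sub_cancel,
        BitVec.toNat_ofNat, Nat.mod_eq_of_lt]
      refine (digitVal_lt (fun v => ?_) _).trans_le ?_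
      · rw [eE, eb]; exact hE _
      · rw [eb, ek, ← pow_mul, mul_comm]
        exact Nat.pow_le_pow_right (by norm_num) hkb

end WordRAM

/-! ### Strings as sequences of digits -/

theorem ofDigits_eq_digitVal (B : ℕ) (l : List ℕ) :
    Nat.ofDigits B l = digitVal B (fun u => l.getD u 0) l.length := by
  induction l with
  | nil => simp [digitVal]
  | cons x l ih =>
    rw [Nat.ofDigits_cons, ih, List.length_cons, add_comm l.length, digitVal_add, pow_one]
    simp [digitVal, add_comm 1]

/-- The letters of a string as numbers. -/
def code {σ : ℕ} (T : List (Fin σ)) (p : ℕ) : ℕ := (T.map Fin.val).getD p 0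

section

variable {σ : ℕ} {T : List (Fin σ)}

theorem length_substr {α : Type*} {T : List α} {i l : ℕ} (h : i + l ≤ T.length) :
    (substr T i l).length = l := by
  simp only [substr, List.length_take, List.length_drop]
  omega

theorem code_substr {i l u : ℕ} (hu : u < l) : code (substr T i l) u = code T (i + u) := by
  simp [code, substr, List.getD_eq_getElem?_getD, hu]

theorem code_lt (hσ : 0 < σ) (p : ℕ) : code T p < σ := by
  rw [code, List.getD_eq_getElem?_getD, List.getElem?_map]
  cases T[p]? with
  | none => exact hσ
  | some x => exact x.isLt

theorem packed_substr (w : ℕ) {i l : ℕ} (h : i + l ≤ T.length) :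
    packed w (substr T i l) =
      lowWords w (digitVal (2 ^ Nat.clog 2 σ) (fun u => code T (i + u)) l)
        ((l * Nat.clog 2 σ) ⌈/⌉ w) := by
  have e : digitVal (2 ^ Nat.clog 2 σ) (fun u => ((substr T i l).map Fin.val).getD u 0) l =
      digitVal (2 ^ Nat.clog 2 σ) (fun u => code T (i + u)) l :=
    digitVal_congr fun u hu => code_substr hu
  rw [packed, length_substr h, ofDigits_eq_digitVal, List.length_map, length_substr h, e, lowWords]

theorem IsStringAttractor.attracts {Γ : Finset ℕ} (h : IsStringAttractor T Γ) :
    Attracts (code T) T.length Γ.toList := by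
  intro x l hl hx
  obtain ⟨x', hx', heq, j, hj, hxj⟩ := h.2 x l hl hx
  refine ⟨x', hx', fun u hu => ?_, j, Finset.mem_toList.2 hj, hxj⟩
  rw [← code_substr hu, heq, code_substr hu]

theorem IsStringAttractor.card_pos {Γ : Finset ℕ} (h : IsStringAttractor T Γ) (hT : T ≠ []) :
    0 < Γ.card := by
  obtain ⟨-, -, -, j, hj, -⟩ := h.2 0 1 one_pos
    (by rw [zero_add]; exact List.length_pos_iff.2 hT)
  exact Finset.card_pos.2 ⟨j, hj⟩

theorem IsStringAttractor.card_le {Γ : Finset ℕ} (h : IsStringAttractor T Γ) :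
    Γ.card ≤ T.length := by
  simpa using Finset.card_le_card (t := Finset.range T.length)
    fun j hj => Finset.mem_range.2 (h.1 j hj)

end

/-! ### The number of levels and the choice of structure -/

namespace WordRAM

/-- The least K for which the blocks cover the text; by minimality the windows of level 1 have total
length at most n. -/
theorem exists_levels {n γ h τ m : ℕ} (hh : 0 < h) (hn : n ≤ γ * τ ^ m) :
    ∃ K ≤ m, n ≤ 4 * γ * (h * τ ^ K) ∧ (K ≠ 0 → 4 * γ * (h * τ ^ (K - 1)) ≤ n) := by
  have hex : n ≤ 4 * γ * (h * τ ^ m) := by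
    rw [show 4 * γ * (h * τ ^ m) = γ * τ ^ m * (4 * h) by ring]
    exact hn.trans (Nat.le_mul_of_pos_right _ (by omega))
  classical
  have hE : ∃ K, n ≤ 4 * γ * (h * τ ^ K) := ⟨m, hex⟩
  refine ⟨Nat.find hE, Nat.find_min' hE hex, Nat.find_spec hE, fun h0 => ?_⟩
  exact (not_le.1 (Nat.find_min hE (Nat.sub_lt (Nat.pos_of_ne_zero h0) one_pos))).le

theorem exists_data_structure {w b k m τ n : ℕ} {c : ℕ → ℕ} {G : List ℕ} (hG : Attracts c n G)
    (hG0 : G ≠ []) (hw : 0 < w) (hb : 0 < b) (hk : 0 < k) (hm : 0 < m) (hkb : k * b ≤ w)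
    (hn : n < 2 ^ w) (hc : ∀ i, c i < 2 ^ b) (hτ : 0 < τ) (hnm : n ≤ G.length * τ ^ m) :
    ∃ D : List (BitVec w),
      D.length ≤ 9 + 4 * G.length * m + min n (4 * G.length * τ * m) ∧
      ∀ y l, y + l ≤ n → ∃ t ≤ 95 * m * (l / (m * k) + 1) + 13,
        Answers extractProg D y l t
          (lowWords w (digitVal (2 ^ b) (fun u => c (y + u)) l) ((l * b) ⌈/⌉ w)) := by
  have hans : ∀ K Z, K ≤ m → (attractorLayout b k m τ K n c G).Stored
      (fun a => ((attractorLayout b k m τ K n c G).words w G Z).getD a 0) →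
      ∀ y l, y + l ≤ n → ∃ t ≤ 95 * m * (l / (m * k) + 1) + 13,
        Answers extractProg ((attractorLayout b k m τ K n c G).words w G Z) y l t
          (lowWords w (digitVal (2 ^ b) (fun u => c (y + u)) l) ((l * b) ⌈/⌉ w)) := by
    intro K Z hK hL y l hyl
    obtain ⟨t, ht, h⟩ := answers_of_stored hL hyl
    refine ⟨t, ht.trans ?_, h⟩
    refine Nat.add_le_add_right (Nat.mul_le_mul_right (l / (m * k) + 1) ?_) 13
    change 9 * K + 25 * m + 61 ≤ 95 * m
    -- Uses K ≤ m and 1 ≤ m: 9K + 25m + 61 ≤ 34m + 61m.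
    omega
  have hplain : ∀ Z, Z = n / k + 1 → (attractorLayout b k m τ 0 n c G).Stored
      fun a => ((attractorLayout b k m τ 0 n c G).words w G Z).getD a 0 := by
    rintro Z rfl
    refine attractorLayout_stored hG hG0 hw hb hk hm hkb hn hc hτ (absurd rfl) ?_ ?_
    · rw [levelLength, if_pos rfl]
      have := Nat.div_add_mod' n k
      have := Nat.mod_lt n hk
      rw [add_mul, one_mul]
      omega
    · intro p hp
      rw [levelLength, if_pos rfl] at hp
      rw [zero_mul, add_zero]
      exact ((Nat.div_le_self _ _).trans_lt hp).trans hn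
  obtain ⟨K, hKm, hnK, hK⟩ := exists_levels (h := m * k) (Nat.mul_pos hm hk) hnm
  have hlen : ∀ K Z, ((attractorLayout b k m τ K n c G).words w G Z).length =
      K * (4 * G.length * τ) + Z + 8 := fun K Z => Layout.length_words _ _ _ _
  have hKS : K * (4 * G.length * τ) ≤ 4 * G.length * τ * m := by
    rw [mul_comm]; exact Nat.mul_le_mul_left _ hKm
  -- Without levels the text has at most 4γ·m·k letters, so packing it takes about 4γm words.
  by_cases hK0 : K = 0
  · refine ⟨_, ?_, hans 0 (n / k + 1) (Nat.zero_le _) (hplain _ rfl)⟩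
    rw [hlen, zero_mul, zero_add]
    have : n / k ≤ 4 * G.length * m := by
      rw [hK0, pow_zero, mul_one, ← mul_assoc] at hnK
      calc n / k ≤ 4 * G.length * m * k / k := Nat.div_le_div_right hnK
        _ = _ := Nat.mul_div_cancel _ hk
    omega
  by_cases hfit : K * (4 * G.length * τ) + 4 * G.length * m ≤ n
  · refine ⟨_, ?_, hans K (4 * G.length * m) hKm (attractorLayout_stored hG hG0 hw hb hk hm hkb hn
      hc hτ (fun h => ⟨hK h, hnK, by omega⟩) ?_ ?_)⟩
    · rw [hlen]
      omega
    · rw [levelLength, if_neg hK0, Nat.sub_self, pow_zero, mul_one, mul_assoc _ m]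
    · intro p hp
      rw [levelLength, if_neg hK0, Nat.sub_self, pow_zero, mul_one, ← mul_assoc,
        ← Nat.div_lt_iff_lt_mul hk] at hp
      omega
  -- Here n is less than the size of the levels, so the packed text is within the same bound.
  · refine ⟨_, ?_, hans 0 (n / k + 1) (Nat.zero_le _) (hplain _ rfl)⟩
    rw [hlen, zero_mul, zero_add]
    have := Nat.div_le_self n k
    omega

end WordRAM

/-! ### Space and time estimates -/

/-- Bernoulli's inequality for (1 + (τ - 1))^y with an exponent y in [0, 1]. -/
theorem le_one_add_mul_logb {x τ : ℝ} (hx : 1 ≤ x) (hτ : 2 ≤ τ) (h : Real.logb τ x ≤ 1) :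
    x ≤ 1 + τ * Real.logb τ x := by
  have h0 : 0 ≤ Real.logb τ x := Real.logb_nonneg (by linarith) hx
  have := rpow_one_add_le_one_add_mul_self (s := τ - 1) (by linarith) h0 h
  rw [add_sub_cancel, Real.rpow_logb (by linarith) (by linarith) (by linarith)] at this
  nlinarith

/-- For x ≥ 1 the number m is at most 2x and the pointers are affordable. For x ≤ 1 the rounding of
m up to 1 would cost γτ words, and the bound n ≤ γ + γτx takes over. -/
theorem space_bound {n γ τ m : ℕ} {x : ℝ} (hγ : 0 < γ) (hγn : γ ≤ n) (hτ : 2 ≤ τ)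
    (hx : x = Real.logb τ ((n : ℝ) / γ)) (hm : (m : ℝ) ≤ 1 + x) :
    ((9 + 4 * γ * m + min n (4 * γ * τ * m) : ℕ) : ℝ) ≤ 400 * (γ + γ * τ * x) := by
  have hγ' : (1 : ℝ) ≤ γ := by exact_mod_cast hγ
  have hτ' : (2 : ℝ) ≤ τ := by exact_mod_cast hτ
  have hq : 1 ≤ (n : ℝ) / γ := by rw [one_le_div (by linarith)]; exact_mod_cast hγn
  have hx0 : 0 ≤ x := hx ▸ Real.logb_nonneg (by linarith) hq
  have h1 : (γ : ℝ) * m ≤ γ * (1 + x) := mul_le_mul_of_nonneg_left hm (by linarith)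
  have h2 : (γ : ℝ) * x ≤ γ * τ * x := by
    have : 0 ≤ (γ : ℝ) * x := by positivity
    nlinarith
  have h3 : 0 ≤ (γ : ℝ) * τ * x := by positivity
  have hmin : ((min n (4 * γ * τ * m) : ℕ) : ℝ) ≤ γ + 8 * (γ * τ * x) := by
    rcases le_total x 1 with h | h
    · have : ((n : ℝ) / γ) ≤ 1 + τ * x := by
        rw [hx] at h ⊢
        exact le_one_add_mul_logb hq hτ' h
      rw [div_le_iff₀ (by linarith)] at this
      have h4 : ((min n (4 * γ * τ * m) : ℕ) : ℝ) ≤ n := by exact_mod_cast min_le_left _ _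
      nlinarith
    · have h4 : ((min n (4 * γ * τ * m) : ℕ) : ℝ) ≤ 4 * γ * τ * m := by
        exact_mod_cast min_le_right _ _
      have h5 : (γ : ℝ) * τ * m ≤ γ * τ * (2 * x) :=
        mul_le_mul_of_nonneg_left (by linarith) (by positivity)
      nlinarith
  rw [Nat.cast_add]
  push_cast at hmin ⊢
  nlinarith

/-- Rounding down in k = w / b loses at most a factor 2 because k ≥ 1, and rounding up the letter
length b at most another one, so l / k ≤ 4·l·s / w. -/
theorem time_bound {w b k m l t : ℕ} {s x : ℝ} (hw : 0 < w) (hb : 0 < b) (hk : k = w / b)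
    (hk0 : 0 < k) (hm : (m : ℝ) ≤ 1 + x) (hx : 0 ≤ x) (hs : (b : ℝ) ≤ 2 * s)
    (ht : t ≤ 95 * m * (l / (m * k) + 1) + 13) : (t : ℝ) ≤ 400 * (1 + x + l * s / w) := by
  have hlk : m * (l / (m * k)) ≤ l / k := by
    rw [mul_comm m k, ← Nat.div_div_eq_div_mul]
    exact Nat.mul_div_le _ _
  have ht' : (t : ℝ) ≤ 95 * (l / k : ℕ) + 95 * m + 13 := by
    have : t ≤ 95 * (l / k) + 95 * m + 13 := by
      refine ht.trans ?_
      rw [mul_add, mul_one, mul_assoc]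
      omega
    exact_mod_cast this
  have hw' : (0 : ℝ) < w := by exact_mod_cast hw
  have hb' : (0 : ℝ) < b := by exact_mod_cast hb
  have hk' : (0 : ℝ) < k := by exact_mod_cast hk0
  have hwk : (w : ℝ) ≤ 2 * b * k := by
    have h1 : w < b * (k + 1) := by rw [hk]; exact Nat.lt_mul_div_succ w hb
    have h2 : b ≤ b * k := Nat.le_mul_of_pos_right b hk0
    have : w ≤ 2 * b * k := by nlinarith
    exact_mod_cast this
  have h1 : ((l / k : ℕ) : ℝ) ≤ 4 * (l * s / w) := by
    refine Nat.cast_div_le.trans ?_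
    rw [← mul_div_assoc, div_le_div_iff₀ hk' hw']
    have hl : (0 : ℝ) ≤ l := Nat.cast_nonneg l
    calc (l : ℝ) * w ≤ l * (2 * b * k) := mul_le_mul_of_nonneg_left hwk hl
      _ ≤ l * (2 * (2 * s) * k) := by gcongr
      _ = _ := by ring
  have h2 : 0 ≤ (l : ℝ) * s / w := by
    have : 0 ≤ s := by linarith
    positivity
  linarith

/-! ### The main theorem -/

theorem mainTheorem8 :
    ∃ (P : List WordRAM.Instr) (C : ℝ), 0 < C ∧
      ∀ (w σ : ℕ) (T : List (Fin σ)) (Γ : Finset ℕ) (τ : ℕ),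
        T ≠ [] → T.length < 2 ^ w → σ ≤ 2 ^ w → IsStringAttractor T Γ → 2 ≤ τ →
        ∃ D : List (BitVec w),
          (D.length : ℝ) ≤
            C * ((Γ.card : ℝ) +
              (Γ.card : ℝ) * (τ : ℝ) * Real.logb τ ((T.length : ℝ) / (Γ.card : ℝ))) ∧
          ∀ i l : ℕ, i + l ≤ T.length →
            ∃ t : ℕ,
              (t : ℝ) ≤
                C * (1 + Real.logb τ ((T.length : ℝ) / (Γ.card : ℝ)) +
                  (l : ℝ) * Real.logb 2 σ / (w : ℝ)) ∧
              WordRAM.Answers P D i l t (packed w (substr T i l)) := by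
  refine ⟨WordRAM.extractProg, 400, by norm_num, ?_⟩
  intro w σ T Γ τ hT hn hσ hΓ hτ
  have hlen : 0 < T.length := List.length_pos_iff.2 hT
  have hw : 0 < w := Nat.pos_of_ne_zero fun h => by rw [h] at hn; omega
  have hσ0 : 0 < σ := (T[0]).pos
  have hγ := hΓ.card_pos hT
  have hγn := hΓ.card_le
  obtain ⟨x, hx⟩ : ∃ x, x = Real.logb τ ((T.length : ℝ) / (Γ.card : ℝ)) := ⟨_, rfl⟩
  have hγ' : (0 : ℝ) < Γ.card := by exact_mod_cast hγ
  have hτ1 : (1 : ℝ) < τ := by exact_mod_cast hτ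
  have hq : 1 ≤ (T.length : ℝ) / Γ.card := by rw [one_le_div hγ']; exact_mod_cast hγn
  have hx0 : 0 ≤ x := hx ▸ Real.logb_nonneg hτ1 hq
  rw [← hx]
  rcases Nat.eq_or_lt_of_le (Nat.succ_le_of_lt hσ0) with hσ1 | hσ2
  -- For σ = 1 letters have no bits and the packed output is empty. In the empty structure cell 1
  -- reads as 0, on which the program stops at once.
  · refine ⟨[], by simpa using by positivity, fun i l hil => ?_⟩
    obtain ⟨t, ht, h⟩ := WordRAM.answers_of_mem_one_eq_zero (w := w) (D := []) rfl i l
    refine ⟨t, ?_, ?_⟩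
    · have : (t : ℝ) ≤ 2 := by exact_mod_cast ht
      rw [← hσ1]
      simp
      linarith
    · have e : Nat.clog 2 σ = 0 := by rw [← hσ1]; rfl
      rw [packed_substr w hil, e]
      simpa [lowWords] using h
  have hb : 0 < Nat.clog 2 σ := Nat.clog_pos (by norm_num) hσ2
  have hbw : Nat.clog 2 σ ≤ w := Nat.clog_le_of_le_pow hσ
  have hk : 0 < w / Nat.clog 2 σ := Nat.div_pos hbw hb
  -- For σ ≥ 2 the logarithm is at least 1, so rounding it up at most doubles it.
  have hs : (Nat.clog 2 σ : ℝ) ≤ 2 * Real.logb 2 σ := by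
    have h1 : 1 ≤ Real.logb 2 σ := by
      rw [Real.le_logb_iff_rpow_le (by norm_num) (by exact_mod_cast hσ0), Real.rpow_one]
      exact_mod_cast hσ2
    have h2 := Nat.ceil_lt_add_one (zero_le_one.trans h1)
    have h3 := Real.natCeil_logb_natCast 2 σ
    rw [Nat.cast_ofNat] at h3
    rw [h3] at h2
    linarith
  obtain ⟨m, hm⟩ : ∃ m, m = max 1 ⌈x⌉₊ := ⟨_, rfl⟩
  have hm0 : 0 < m := by omega
  have hmx : (m : ℝ) ≤ 1 + x := by
    rw [hm, Nat.cast_max]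
    have := Nat.ceil_lt_add_one hx0
    refine max_le ?_ ?_
    · push_cast; linarith
    · linarith
  have hnm : T.length ≤ Γ.toList.length * τ ^ m := by
    have h1 : x ≤ m := (Nat.le_ceil x).trans (by exact_mod_cast hm ▸ le_max_right _ _)
    rw [hx, Real.logb_le_iff_le_rpow hτ1 (by linarith), Real.rpow_natCast, div_le_iff₀ hγ'] at h1
    rw [Finset.length_toList, mul_comm]
    exact_mod_cast h1
  obtain ⟨D, hD, hans⟩ := WordRAM.exists_data_structure hΓ.attracts
    (fun h => hγ.ne' (by rw [← Finset.length_toList, h]; rfl)) hw hb hk hm0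
    (Nat.div_mul_le_self _ _) hn
    (fun i => (code_lt hσ0 i).trans_le (Nat.le_pow_clog (by norm_num) σ)) (by omega) hnm
  refine ⟨D, ?_, fun i l hil => ?_⟩
  · rw [Finset.length_toList] at hD
    refine le_trans ?_ (space_bound hγ hγn hτ hx hmx)
    exact_mod_cast hD
  · obtain ⟨t, ht, h⟩ := hans i l hil
    refine ⟨t, time_bound hw hb rfl hk hmx hx0 hs ht, ?_⟩
    rw [packed_substr w hil]
    exact h
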